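/- Let $k\ge 2$, let $\sigma=\sigma_0\sigma_1\cdots\sigma_{k-1}\in\{+,-\}^k$, let $n\ge 1$, and let $\pi=\pi_1\pi_2\cdots\pi_n$ be a permutation of $\{1,\dots,n\}$ in one-line notation. Let $\mathcal W_k$ be the set of infinite words $w=w_1w_2w_3\cdots$ over the alphabet $\{0,1,\dots,k-1\}$, with the linear order $\prec_\sigma$ in which $v\prec_\sigma w$ if and only if $v_1<w_1$, or $v_1=w_1=t$ with $\sigma_t=+$ and $v_2v_3\cdots\prec_\sigma w_2w_3\cdots$, or $v_1=w_1=t$ with $\sigma_t=-$ and $w_2w_3\cdots\prec_\sigma v_2v_3\cdots$ (explicitly: if $j$ is the first index with $v_j\neq w_j$, then $v\prec_\sigma w$ holds when $v_j<w_j$ and the number of $i<j$ with $\sigma_{v_i}=-$ is even, or $v_j>w_j$ and that number is odd). The signed shift $\Sigma_\sigma:\mathcal W_k\to\mathcal W_k$ is $\Sigma_\sigma(w_1w_2w_3\cdots)=w_2w_3\cdots$. The permutation $\pi$ is an allowed pattern of $\Sigma_\sigma$ if there is $w\in\mathcal W_k$ such that the $n$ words $w,\Sigma_\sigma(w),\dots,\Sigma_\sigma^{n-1}(w)$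 are distinct and, for all $1\le i,j\le n$, $\Sigma_\sigma^{i-1}(w)\prec_\sigma\Sigma_\sigma^{j-1}(w)$ if and only if $\pi_i<\pi_j$. The marked cycle $\hat\pi^\star=\hat\pi^\star_1\hat\pi^\star_2\cdots\hat\pi^\star_n$ is the sequence defined by $\hat\pi^\star_{\pi_i}=\pi_{i+1}$ for $1\le i\le n-1$ and $\hat\pi^\star_{\pi_n}=\star$. A $\sigma$-segmentation of $\hat\pi^\star$ is a sequence of integers $0=e_0\le e_1\le\dots\le e_k=n$ such that (a condition that mentions positions outside $1,\dots,n$ being void): (a) for all $0\le t\le k-1$, the sequence $\hat\pi^\star_{e_t+1}\cdots\hat\pi^\star_{e_{t+1}}$, after deletion of $\star$ if it occurs, is increasing if $\sigma_t=+$ and decreasing if $\sigma_t=-$; (b) if $\sigma_0=+$ and $\hat\pi^\star_1\hat\pi^\star_2=\star1$, then $e_1=0$; (c) if $\sigma_{k-1}=+$ and $\hat\pi^\star_{n-1}\hat\pi^\star_n=n\star$, then $e_{k-1}=n-1$; (d) if $\sigma_0=\sigma_{k-1}=-$, $\hat\pi^\star_1=n$ and $\hat\pi^\star_{n-1}\hat\pi^\star_n=1\star$,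 then $e_1=0$ or $e_{k-1}=n-1$; (e) if $\sigma_0=\sigma_{k-1}=-$, $\hat\pi^\star_1\hat\pi^\star_2=\star n$ and $\hat\pi^\star_n=1$, then $e_1=0$ or $e_{k-1}=n$; (f) $e_t\ne\pi_n$ for all $1\le t\le k-1$. The associated prefix is the word $\zeta=z_1z_2\cdots z_{n-1}$ with $z_i=j$ whenever $e_j<\pi_i\le e_{j+1}$. The segmentation is called invalid if $\pi_n\notin\{1,n\}$ and, with $x,y$ the indices such that $\pi_x=\pi_n+1$ and $\pi_y=\pi_n-1$, and with $p=z_xz_{x+1}\cdots z_{n-1}$ and $q=z_yz_{y+1}\cdots z_{n-1}$, one has $p=qq$ or $q=pp$. Otherwise it is called valid. Theorem. The permutation $\pi$ is an allowed pattern of $\Sigma_\sigma$ if and only if there exists a valid $\sigma$-segmentation of $\hat\pi^\star$. -/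

import Mathlib

/-! Indices and values are counted from `0`: the word `w₁w₂…` is `w 0, w 1, …`, and the permutation
`π₁π₂…πₙ` of `{1, …, n}` is the permutation `π` of `Fin n` with `(π i : ℕ) + 1` as its
`(i + 1)`-st entry.  The bars `e t` of a segmentation are the same integers in `{0, …, n}` as usual:
they separate the first `e t` positions from the remaining ones. -/

/-- The point `x` induces the pattern `π` of length `n` under `f : X → X`: the values
`x, f x, …, f^(n-1) x` are distinct and are in the same relative order as the entries of `π`. -/
def Induces {X : Type*} [LinearOrder X] (f : X → X) (x : X) {n : ℕ}
    (π : Equiv.Perm (Fin n)) : Prop :=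
  Function.Injective (fun i : Fin n => f^[(i : ℕ)] x) ∧
    ∀ i j : Fin n, f^[(i : ℕ)] x < f^[(j : ℕ)] x ↔ π i < π j

/-- The permutation `π` is an allowed pattern of `f`. -/
def IsAllowedPattern {X : Type*} [LinearOrder X] (f : X → X) {n : ℕ}
    (π : Equiv.Perm (Fin n)) : Prop :=
  ∃ x : X, Induces f x π

/-- Infinite words on the alphabet `{0, …, k - 1}`; the signature `σ` is recorded in the type
because it determines the order on words. A signature has the values `1` (for `+`)
and `-1` (for `-`). -/
def SignedWord {k : ℕ} (_σ : Fin k → ℤˣ) : Type := ℕ → Fin k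

/-- The signed shift `w₁w₂w₃… ↦ w₂w₃…`. -/
def signedShift {k : ℕ} (σ : Fin k → ℤˣ) (w : SignedWord σ) : SignedWord σ :=
  fun i => w (i + 1)

/-- The strict order on words given by a signature. -/
inductive SignedLess {k : ℕ} (σ : Fin k → ℤˣ) : SignedWord σ → SignedWord σ → Prop
  | first {v w : SignedWord σ} : v 0 < w 0 → SignedLess σ v w
  | pos {v w : SignedWord σ} : v 0 = w 0 → σ (v 0) = 1 →
      SignedLess σ (signedShift σ v) (signedShift σ w) → SignedLess σ v w
  | neg {v w : SignedWord σ} : v 0 = w 0 → σ (v 0) = -1 →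
      SignedLess σ (signedShift σ w) (signedShift σ v) → SignedLess σ v w

theorem SignedLess.ne {k : ℕ} {σ : Fin k → ℤˣ} {v w : SignedWord σ} (h : SignedLess σ v w) :
    v ≠ w := by
  induction h with
  | first h => rintro rfl; exact lt_irrefl _ h
  | pos _ _ _ ih => rintro rfl; exact ih rfl
  | neg _ _ _ ih => rintro rfl; exact ih rfl

theorem SignedLess.trans_aux {k : ℕ} {σ : Fin k → ℤˣ} {v w : SignedWord σ}
    (h : SignedLess σ v w) :
    (∀ u, SignedLess σ w u → SignedLess σ v u) ∧ (∀ u, SignedLess σ u v → SignedLess σ u w) := by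
  induction h with
  | @first v w h =>
    refine ⟨fun u hu => ?_, fun u hu => ?_⟩
    · cases hu with
      | first h' => exact .first (h.trans h')
      | pos h' _ _ => exact .first (h' ▸ h)
      | neg h' _ _ => exact .first (h' ▸ h)
    · cases hu with
      | first h' => exact .first (h'.trans h)
      | pos h' _ _ => exact .first (h' ▸ h)
      | neg h' _ _ => exact .first (h' ▸ h)
  | @pos v w h hs _ ih =>
    refine ⟨fun u hu => ?_, fun u hu => ?_⟩
    · cases hu with
      | first h' => exact .first (h ▸ h')
      | pos h' _ h₃ => exact .pos (h.trans h') hs (ih.1 _ h₃)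
      | neg h' h₂ _ => rw [← h, hs] at h₂; exact absurd h₂ (by decide)
    · cases hu with
      | first h' => exact .first (h ▸ h')
      | pos h' h₂ h₃ => exact .pos (h'.trans h) h₂ (ih.2 _ h₃)
      | neg h' h₂ _ => rw [h', hs] at h₂; exact absurd h₂ (by decide)
  | @neg v w h hs _ ih =>
    refine ⟨fun u hu => ?_, fun u hu => ?_⟩
    · cases hu with
      | first h' => exact .first (h ▸ h')
      | pos h' h₂ _ => rw [← h, hs] at h₂; exact absurd h₂ (by decide)
      | neg h' _ h₃ => exact .neg (h.trans h') hs (ih.2 _ h₃)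
    · cases hu with
      | first h' => exact .first (h ▸ h')
      | pos h' h₂ _ => rw [h', hs] at h₂; exact absurd h₂ (by decide)
      | neg h' h₂ h₃ => exact .neg (h'.trans h) h₂ (ih.1 _ h₃)

theorem SignedLess.total_aux {k : ℕ} {σ : Fin k → ℤˣ} (m : ℕ) :
    ∀ v w : SignedWord σ, v m ≠ w m → SignedLess σ v w ∨ SignedLess σ w v := by
  induction m with
  | zero =>
    intro v w h
    exact (lt_or_gt_of_ne h).imp .first .first
  | succ m ih =>
    intro v w h
    rcases lt_trichotomy (v 0) (w 0) with h₀ | h₀ | h₀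
    · exact .inl (.first h₀)
    · have := ih (signedShift σ v) (signedShift σ w) h
      rcases Int.units_eq_one_or (σ (v 0)) with hs | hs
      · exact this.imp (.pos h₀ hs) (.pos h₀.symm (h₀ ▸ hs))
      · exact this.symm.imp (.neg h₀ hs) (.neg h₀.symm (h₀ ▸ hs))
    · exact .inr (.first h₀)

open Classical in
/-- The linear order on infinite words whose strict order is `SignedLess σ`. -/
noncomputable instance {k : ℕ} (σ : Fin k → ℤˣ) : LinearOrder (SignedWord σ) where
  le v w := v = w ∨ SignedLess σ v w
  lt := SignedLess σ
  le_refl _ := .inl rfl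
  le_trans u v w h₁ h₂ := by
    rcases h₁ with rfl | h₁
    · exact h₂
    · rcases h₂ with rfl | h₂
      · exact .inr h₁
      · exact .inr (h₁.trans_aux.1 _ h₂)
  lt_iff_le_not_ge v w := by
    refine ⟨fun h => ⟨.inr h, ?_⟩, ?_⟩
    · rintro (h' | h')
      · exact h.ne h'.symm
      · exact (h.trans_aux.1 _ h').ne rfl
    · rintro ⟨rfl | h, h'⟩
      · exact absurd (Or.inl rfl) h'
      · exact h
  le_antisymm v w h₁ h₂ := by
    rcases h₁ with rfl | h₁
    · rfl
    · rcases h₂ with h₂ | h₂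
      · exact h₂.symm
      · exact absurd rfl (h₁.trans_aux.1 _ h₂).ne
  le_total v w := by
    by_cases h : v = w
    · exact .inl (.inl h)
    · obtain ⟨m, hm⟩ := Function.ne_iff.mp h
      exact (SignedLess.total_aux m v w hm).imp .inr .inr
  toDecidableLE := Classical.decRel _

/-- The marked cycle of `π` in one-line notation, with `none` in the role of the star: the entry at
position `j` is the entry to the right of `j` in the one-line notation of `π`, and it is the star if
`j` is the last entry of `π`. -/
def markedCycle {n : ℕ} (π : Equiv.Perm (Fin n)) (j : Fin n) : Option (Fin n) :=
  if h : (π.symm j : ℕ) + 1 < n then some (π ⟨(π.symm j : ℕ) + 1, h⟩) else none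

/-- The block of `c` at the positions `a + 1, …, b` (counted from `1`) is increasing once the star
is deleted. -/
def BlockIncreasing {n : ℕ} (c : Fin n → Option (Fin n)) (a b : ℕ) : Prop :=
  ∀ i j : Fin n, a ≤ (i : ℕ) → i < j → (j : ℕ) < b →
    ∀ u v : Fin n, c i = some u → c j = some v → u < v

/-- The block of `c` at the positions `a + 1, …, b` (counted from `1`) is decreasing once the star
is deleted. -/
def BlockDecreasing {n : ℕ} (c : Fin n → Option (Fin n)) (a b : ℕ) : Prop :=
  ∀ i j : Fin n, a ≤ (i : ℕ) → i < j → (j : ℕ) < b →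
    ∀ u v : Fin n, c i = some u → c j = some v → v < u

/-- `EntryEq c j u`, with positions and values counted from `1`: position `j` exists in the
sequence `c` of length `n`, and the entry there is the number `u`. -/
def EntryEq {n : ℕ} (c : Fin n → Option (Fin n)) (j u : ℕ) : Prop :=
  ∃ i v : Fin n, (i : ℕ) + 1 = j ∧ (v : ℕ) + 1 = u ∧ c i = some v

/-- `EntryStar c j`, with positions counted from `1`: position `j` exists in the sequence `c` of
length `n`, and the entry there is the star. -/
def EntryStar {n : ℕ} (c : Fin n → Option (Fin n)) (j : ℕ) : Prop :=
  ∃ i : Fin n, (i : ℕ) + 1 = j ∧ c i = none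

/-- A `σ`-segmentation of the marked cycle of a permutation `π` of length `n ≥ 1`, for a signature
`σ` of length `k ≥ 2`. -/
structure Segmentation {k n : ℕ} (hk : 2 ≤ k) (hn : 1 ≤ n) (σ : Fin k → ℤˣ)
    (π : Equiv.Perm (Fin n)) where
  /-- The indices `e₀, …, e_k`. -/
  e : Fin (k + 1) → ℕ
  mono : Monotone e
  e_zero : e 0 = 0
  e_last : e (Fin.last k) = n
  /-- The block of a letter with sign `+` is increasing. -/
  increasing : ∀ t : Fin k, σ t = 1 → BlockIncreasing (markedCycle π) (e t.castSucc) (e t.succ)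
  /-- The block of a letter with sign `-` is decreasing. -/
  decreasing : ∀ t : Fin k, σ t = -1 → BlockDecreasing (markedCycle π) (e t.castSucc) (e t.succ)
  /-- If `σ₀ = +` and the marked cycle begins with `⋆ 1`, then `e₁ = 0`. -/
  cond_b : σ ⟨0, by omega⟩ = 1 →
    EntryStar (markedCycle π) 1 → EntryEq (markedCycle π) 2 1 → e ⟨1, by omega⟩ = 0
  /-- If `σ_{k-1} = +` and the marked cycle ends with `n ⋆`, then `e_{k-1} = n - 1`. -/
  cond_c : σ ⟨k - 1, by omega⟩ = 1 →
    EntryEq (markedCycle π) (n - 1) n → EntryStar (markedCycle π) n →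
      e ⟨k - 1, by omega⟩ = n - 1
  /-- If `σ₀ = σ_{k-1} = -` and the marked cycle begins with `n` and ends with `1 ⋆`, then
  `e₁ = 0` or `e_{k-1} = n - 1`. -/
  cond_d : σ ⟨0, by omega⟩ = -1 → σ ⟨k - 1, by omega⟩ = -1 →
    EntryEq (markedCycle π) 1 n → EntryEq (markedCycle π) (n - 1) 1 →
      EntryStar (markedCycle π) n →
        e ⟨1, by omega⟩ = 0 ∨ e ⟨k - 1, by omega⟩ = n - 1
  /-- If `σ₀ = σ_{k-1} = -` and the marked cycle begins with `⋆ n` and ends with `1`, then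
  `e₁ = 0` or `e_{k-1} = n`. -/
  cond_e : σ ⟨0, by omega⟩ = -1 → σ ⟨k - 1, by omega⟩ = -1 →
    EntryStar (markedCycle π) 1 → EntryEq (markedCycle π) 2 n → EntryEq (markedCycle π) n 1 →
      e ⟨1, by omega⟩ = 0 ∨ e ⟨k - 1, by omega⟩ = n
  /-- `e_t ≠ π_n` for `1 ≤ t ≤ k - 1`. -/
  cond_f : ∀ t : Fin (k + 1), 1 ≤ (t : ℕ) → (t : ℕ) ≤ k - 1 →
    e t ≠ (π ⟨n - 1, by omega⟩ : ℕ) + 1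

namespace Segmentation

theorem exists_letter {k n : ℕ} {hk : 2 ≤ k} {hn : 1 ≤ n} {σ : Fin k → ℤˣ}
    {π : Equiv.Perm (Fin n)} (E : Segmentation hk hn σ π) (i : Fin n) :
    ∃ j : Fin k, E.e j.castSucc < (π i : ℕ) + 1 ∧ (π i : ℕ) + 1 ≤ E.e j.succ := by
  by_contra! h
  have key : ∀ t : Fin (k + 1), E.e t < (π i : ℕ) + 1 := by
    intro t
    induction t using Fin.induction with
    | zero => rw [E.e_zero]; omega
    | succ j ih => exact h j ih
  have h₁ := key (Fin.last k)
  rw [E.e_last] at h₁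
  have := (π i).isLt
  omega

/-- The letter `z_i`: the (unique) letter `j` with `e_j < π_i ≤ e_{j+1}`. -/
noncomputable def letter {k n : ℕ} {hk : 2 ≤ k} {hn : 1 ≤ n} {σ : Fin k → ℤˣ}
    {π : Equiv.Perm (Fin n)} (E : Segmentation hk hn σ π) (i : Fin n) : Fin k :=
  (E.exists_letter i).choose

/-- The associated word `ζ = z₁ … z_{n-1}`. -/
noncomputable def word {k n : ℕ} {hk : 2 ≤ k} {hn : 1 ≤ n} {σ : Fin k → ℤˣ}
    {π : Equiv.Perm (Fin n)} (E : Segmentation hk hn σ π) : List (Fin k) :=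
  List.ofFn fun i : Fin (n - 1) => E.letter ⟨i, by omega⟩

/-- The segmentation is invalid: the entries `π_n + 1` (at the index `x`) and `π_n - 1` (at the
index `y`) both occur in `π`, and the suffixes `p` and `q` of the associated word that
start at the indices `x` and `y` satisfy `p = q²` or `q = p²`. -/
def IsInvalid {k n : ℕ} {hk : 2 ≤ k} {hn : 1 ≤ n} {σ : Fin k → ℤˣ}
    {π : Equiv.Perm (Fin n)} (E : Segmentation hk hn σ π) : Prop :=
  ∃ x y : Fin n,
    (π x : ℕ) = (π ⟨n - 1, by omega⟩ : ℕ) + 1 ∧ (π y : ℕ) + 1 = (π ⟨n - 1, by omega⟩ : ℕ) ∧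
      (E.word.drop x = E.word.drop y ++ E.word.drop y ∨
        E.word.drop y = E.word.drop x ++ E.word.drop x)

/-- The segmentation is valid. -/
def IsValid {k n : ℕ} {hk : 2 ≤ k} {hn : 1 ≤ n} {σ : Fin k → ℤˣ}
    {π : Equiv.Perm (Fin n)} (E : Segmentation hk hn σ π) : Prop :=
  ¬ E.IsInvalid

end Segmentation

/-! Write a word as ζu, where ζ consists of its first n-1 letters. Its first n shifts are the words
su for the suffixes s of ζ, the empty one included. The decisive fact is `lt_prepend_iff`: for
nonempty s of either sign, u < su exactly when u < s^∞. Let q_i be the periodic word with period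
z_i…z_{n-1}. If ζ is consistent with π letter by letter (`IsCompatible`), then ζu induces π exactly
when u lies above every q_i with π_i < π_n and below every q_i with π_i > π_n. Indeed, two suffixes
either differ at a letter, and compatibility settles their order, or one is a prefix of the other,
and deleting it leaves a comparison of u with some su (`prepend_lt_prepend`).

The question is thus whether this gap contains a word. If π_n is neither 1 nor n, `periodic_le`
shows that q_y is the largest lower bound in play, q_x the smallest upper bound, and q_y ≤ q_x. When
q_y < q_x there is a word in between (`exists_between_periodic`); equality forces one of p, q to be
the square of the other (`eq_append_self_of_periodic_eq`), which is invalidity. If π_n is 1 or n,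
the best candidate for u is the smallest or largest word. It fails only if some q_i equals it, and
conditions (b) and (e), respectively (c) and (d), exclude this.

Conversely, the letters of a word inducing π, sorted by position, determine the bars. The gap then
contains u, so no q_i is extreme on the wrong side and q_y < q_x; this gives (b)–(e) and validity.
-/

namespace SignedWord

/-! ### Prefixes, signs and periodic words -/

variable {k : ℕ} {σ : Fin k → ℤˣ}

/-- The word with first letter `t` followed by the word `w`. -/
def cons (t : Fin k) (w : SignedWord σ) : SignedWord σ
  | 0 => t
  | i + 1 => w i

/-- The infinite word `l u`, for a finite word `l`. -/
def prepend : List (Fin k) → SignedWord σ → SignedWord σ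
  | [], u => u
  | t :: l, u => cons t (prepend l u)

theorem cons_shift (w : SignedWord σ) : cons (w 0) (signedShift σ w) = w := by
  funext i
  cases i <;> rfl

theorem cons_lt_cons_of_lt {t t' : Fin k} (h : t < t') (v w : SignedWord σ) :
    cons t v < cons t' w :=
  SignedLess.first h

theorem cons_strictMono {t : Fin k} (h : σ t = 1) :
    StrictMono (cons t : SignedWord σ → SignedWord σ) :=
  fun _ _ hvw => SignedLess.pos rfl h hvw

theorem cons_strictAnti {t : Fin k} (h : σ t = -1) :
    StrictAnti (cons t : SignedWord σ → SignedWord σ) :=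
  fun _ _ hvw => SignedLess.neg rfl h hvw

theorem prepend_append (l m : List (Fin k)) (u : SignedWord σ) :
    prepend (l ++ m) u = prepend l (prepend m u) := by
  induction l with
  | nil => rfl
  | cons t l ih => simp [prepend, ih]

theorem shift_iterate_prepend (u : SignedWord σ) (l : List (Fin k)) :
    ∀ i, i ≤ l.length → (signedShift σ)^[i] (prepend l u) = prepend (l.drop i) u := by
  induction l with
  | nil => intro i hi; obtain rfl : i = 0 := by simpa using hi
           rfl
  | cons t l ih =>
    intro i hi
    cases i with
    | zero => rfl
    | succ i => exact ih i (by simpa using hi)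

variable (σ) in
/-- The sign of a finite word. -/
def sign (l : List (Fin k)) : ℤˣ := (l.map σ).prod

@[simp] theorem sign_nil : sign σ [] = 1 := rfl

@[simp] theorem sign_cons (t : Fin k) (l : List (Fin k)) : sign σ (t :: l) = σ t * sign σ l := by
  simp [sign]

@[simp] theorem sign_append (l m : List (Fin k)) : sign σ (l ++ m) = sign σ l * sign σ m := by
  simp [sign]

theorem prepend_monotonicity (l : List (Fin k)) :
    (sign σ l = 1 → StrictMono (prepend l : SignedWord σ → SignedWord σ)) ∧
      (sign σ l = -1 → StrictAnti (prepend l : SignedWord σ → SignedWord σ)) := by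
  induction l with
  | nil => exact ⟨fun _ => strictMono_id, fun h => absurd (sign_nil (σ := σ) ▸ h) (by decide)⟩
  | cons t l ih =>
    rcases Int.units_eq_one_or (σ t) with ht | ht <;>
      rcases Int.units_eq_one_or (sign σ l) with hl | hl <;>
        simp only [sign_cons, ht, hl]
    · exact ⟨fun _ => (cons_strictMono ht).comp (ih.1 hl), fun h => absurd h (by decide)⟩
    · exact ⟨fun h => absurd h (by decide), fun _ => (cons_strictMono ht).comp_strictAnti (ih.2 hl)⟩
    · exact ⟨fun h => absurd h (by decide), fun _ => (cons_strictAnti ht).comp_strictMono (ih.1 hl)⟩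
    · exact ⟨fun _ => (cons_strictAnti ht).comp (ih.2 hl), fun h => absurd h (by decide)⟩

theorem prepend_strictMono {l : List (Fin k)} (h : sign σ l = 1) :
    StrictMono (prepend l : SignedWord σ → SignedWord σ) :=
  (prepend_monotonicity l).1 h

theorem prepend_strictAnti {l : List (Fin k)} (h : sign σ l = -1) :
    StrictAnti (prepend l : SignedWord σ → SignedWord σ) :=
  (prepend_monotonicity l).2 h

theorem prepend_apply_add (l : List (Fin k)) (u : SignedWord σ) (i : ℕ) :
    prepend l u (l.length + i) = u i := by
  induction l with
  | nil => simp [prepend]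
  | cons t l ih =>
    rw [List.length_cons, show l.length + 1 + i = (l.length + i) + 1 by omega]
    exact ih

theorem prepend_apply_lt (l : List (Fin k)) (u : SignedWord σ) :
    ∀ (i : ℕ) (hi : i < l.length), prepend l u i = l[i] := by
  induction l with
  | nil => intro i hi; simp at hi
  | cons t l ih =>
    intro i hi
    cases i with
    | zero => rfl
    | succ i => exact ih i (by simpa using hi)

theorem exists_of_prepend_ne {l : List (Fin k)} {u v : SignedWord σ} {m : ℕ}
    (h : prepend l u m ≠ prepend l v m) : ∃ i, m = l.length + i ∧ u i ≠ v i := by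
  rcases lt_or_ge m l.length with hm | hm
  · exact absurd (by rw [prepend_apply_lt _ _ _ hm, prepend_apply_lt _ _ _ hm]) h
  · obtain ⟨i, rfl⟩ := Nat.exists_eq_add_of_le hm
    exact ⟨i, rfl, by rwa [prepend_apply_add, prepend_apply_add] at h⟩

/-- The periodic word with a given period. -/
theorem exists_prepend_eq_self {p : List (Fin k)} (hp : p ≠ []) :
    ∃ v : SignedWord σ, prepend p v = v := by
  have hl : 0 < p.length := List.length_pos_iff.2 hp
  obtain ⟨v, hv⟩ : ∃ v : SignedWord σ, ∀ i, v i = p[i % p.length]'(Nat.mod_lt _ hl) :=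
    ⟨fun i => p[i % p.length]'(Nat.mod_lt _ hl), fun _ => rfl⟩
  refine ⟨v, ?_⟩
  funext m
  rw [hv]
  rcases lt_or_ge m p.length with hm | hm
  · rw [prepend_apply_lt _ _ _ hm]
    simp [Nat.mod_eq_of_lt hm]
  · obtain ⟨i, rfl⟩ := Nat.exists_eq_add_of_le hm
    rw [prepend_apply_add, hv]
    simp

/-- A disagreement of two fixed points must lie beyond p, and moving it back by the length of p
yields an earlier one. -/
theorem eq_of_prepend_eq_self {p : List (Fin k)} (hp : p ≠ []) {v w : SignedWord σ}
    (hv : prepend p v = v) (hw : prepend p w = w) : v = w := by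
  have hl : 0 < p.length := List.length_pos_iff.2 hp
  funext m
  induction m using Nat.strong_induction_on with
  | _ m ih =>
    by_contra h
    rw [← hv, ← hw] at h
    obtain ⟨i, rfl, hi⟩ := exists_of_prepend_ne h
    exact hi (ih i (by omega))

/-- If u does not begin with p, its comparison with a word that does is settled inside p, so the
tail is irrelevant. -/
theorem lt_prepend_iff_of_not_prefix (p : List (Fin k)) :
    ∀ u : SignedWord σ, (∀ u', u ≠ prepend p u') → ∀ a b, u < prepend p a → u < prepend p b := by
  -- Both directions go through the induction together, since a negative letter exchanges them.
  suffices H : ∀ u : SignedWord σ, (∀ u', u ≠ prepend p u') → ∀ a b,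
      (u < prepend p a → u < prepend p b) ∧ (prepend p a < u → prepend p b < u) from
    fun u hu a b => (H u hu a b).1
  induction p with
  | nil => exact fun u hu => absurd rfl (hu u)
  | cons t l ih =>
    intro u hu a b
    simp only [prepend] at hu ⊢
    obtain ⟨s, v, rfl⟩ : ∃ s v, u = cons s v := ⟨_, _, (cons_shift u).symm⟩
    rcases lt_trichotomy s t with h | rfl | h
    · exact ⟨fun _ => cons_lt_cons_of_lt h _ _,
        fun h' => absurd h' (cons_lt_cons_of_lt h _ _).asymm⟩
    · have := ih v (fun u' h => hu u' (by rw [h])) a b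
      rcases Int.units_eq_one_or (σ s) with hs | hs
      · simpa only [(cons_strictMono hs).lt_iff_lt] using this
      · simpa only [(cons_strictAnti hs).lt_iff_gt] using this.symm
    · exact ⟨fun h' => absurd h' (cons_lt_cons_of_lt h _ _).asymm,
        fun _ => cons_lt_cons_of_lt h _ _⟩

/-- A word compares with its image under prepending `p` as it compares with the periodic word
of period `p`, whatever the sign of `p`. -/
theorem lt_prepend_iff {p : List (Fin k)} (hp : p ≠ []) {v : SignedWord σ} (hv : prepend p v = v)
    (u : SignedWord σ) : u < prepend p u ↔ u < v := by
  have hl : 0 < p.length := List.length_pos_iff.2 hp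
  by_cases huv : u = v
  · rw [huv, hv]
  obtain ⟨m, hm⟩ := Function.ne_iff.1 huv
  -- Here m is any index at which u and v differ; removing a leading p from u lowers it by the
  -- length of p.
  induction m using Nat.strong_induction_on generalizing u with
  | _ m ih =>
    by_cases h : ∃ u', u = prepend p u'
    · obtain ⟨u, rfl⟩ := h
      have hm' := hm
      rw [← hv] at hm'
      obtain ⟨i, rfl, hi⟩ := exists_of_prepend_ne hm'
      have hne : u ≠ v := fun h => hi (by rw [h])
      have hne' : u ≠ prepend p u := fun h => hne (eq_of_prepend_eq_self hp h.symm hv)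
      have key := ih i (by omega) u hne hi
      suffices H : prepend p u < prepend p (prepend p u) ↔ prepend p u < prepend p v by
        rwa [hv] at H
      rcases Int.units_eq_one_or (sign σ p) with hs | hs
      · rwa [(prepend_strictMono hs).lt_iff_lt, (prepend_strictMono hs).lt_iff_lt]
      -- A negative p reverses both comparisons. As neither is an equality, the reversed equivalence
      -- is the negation of the induction hypothesis.
      · rw [(prepend_strictAnti hs).lt_iff_gt, (prepend_strictAnti hs).lt_iff_gt,
          ← not_iff_not, not_lt, not_lt, hne.le_iff_lt, hne'.le_iff_lt]
        exact key
    · push Not at h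
      have := lt_prepend_iff_of_not_prefix p u h
      exact ⟨fun h => hv ▸ this _ v h, fun h => this v _ (hv.symm ▸ h)⟩

theorem prepend_lt_iff {p : List (Fin k)} (hp : p ≠ []) {v : SignedWord σ} (hv : prepend p v = v)
    (u : SignedWord σ) : prepend p u < u ↔ v < u := by
  by_cases huv : u = v
  · rw [huv, hv]
  have hne : u ≠ prepend p u := fun h => huv (eq_of_prepend_eq_self hp h.symm hv)
  have := lt_prepend_iff hp hv u
  rwa [← not_iff_not, not_lt, not_lt, hne.le_iff_lt, Ne.le_iff_lt huv]

/-- The witness is ppw. The square pp has sign + whatever p is, so v = ppv < ppw, and ppw < w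
because v, the periodic word of pp, lies below w. -/
theorem exists_between_periodic {p : List (Fin k)} (hp : p ≠ []) {v w : SignedWord σ}
    (hv : prepend p v = v) (hvw : v < w) : ∃ u, v < u ∧ u < w := by
  have h2 : prepend (p ++ p) v = v := by rw [prepend_append, hv, hv]
  have hs : sign σ (p ++ p) = 1 := by rw [sign_append, Int.units_mul_self]
  refine ⟨prepend (p ++ p) w, ?_, (prepend_lt_iff (by simpa) h2 w).2 hvw⟩
  conv_lhs => rw [← h2]
  exact prepend_strictMono hs hvw

/-! ### Comparing (ab)^∞ with a^∞ and b^∞ -/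

section Products

variable {a b : List (Fin k)} {va vb v : SignedWord σ}

/-- The conjugate periodic word `(ba)^∞` in terms of `v = (ab)^∞`. -/
theorem prepend_prepend_of_append (hv : prepend (a ++ b) v = v) :
    prepend a (prepend b v) = v := by
  rw [← prepend_append, hv]

theorem prepend_lt_self_iff_conj (ha : a ≠ []) (hva : prepend a va = va)
    (hv : prepend (a ++ b) v = v) : prepend b v < v ↔ prepend b v < va := by
  have := lt_prepend_iff ha hva (prepend b v)
  rwa [prepend_prepend_of_append hv] at this

theorem self_lt_prepend_iff_conj (ha : a ≠ []) (hva : prepend a va = va)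
    (hv : prepend (a ++ b) v = v) : v < prepend b v ↔ va < prepend b v := by
  have := prepend_lt_iff ha hva (prepend b v)
  rwa [prepend_prepend_of_append hv] at this

/-- Suppose a^∞ < v. Then b^∞ < v, hence bv < v = a(bv), which means bv < a^∞. Prepending the
increasing a gives v < a^∞, a contradiction. -/
theorem le_of_sign_one (ha : a ≠ []) (hb : b ≠ []) (hs : sign σ a = 1) (hva : prepend a va = va)
    (hvb : prepend b vb = vb) (hv : prepend (a ++ b) v = v) (h : vb ≤ va) : v ≤ va := by
  by_contra! hlt
  have h1 : prepend b v < v := (prepend_lt_iff hb hvb v).2 (h.trans_lt hlt)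
  have h2 := prepend_strictMono hs ((prepend_lt_self_iff_conj ha hva hv).1 h1)
  rw [prepend_prepend_of_append hv, hva] at h2
  exact h2.asymm hlt

theorem ge_of_sign_one (ha : a ≠ []) (hb : b ≠ []) (hs : sign σ a = 1) (hva : prepend a va = va)
    (hvb : prepend b vb = vb) (hv : prepend (a ++ b) v = v) (h : va ≤ vb) : va ≤ v := by
  by_contra! hlt
  have h1 : v < prepend b v := (lt_prepend_iff hb hvb v).2 (hlt.trans_le h)
  have h2 := prepend_strictMono hs ((self_lt_prepend_iff_conj ha hva hv).1 h1)
  rw [prepend_prepend_of_append hv, hva] at h2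
  exact h2.asymm hlt

/-- Suppose a^∞ < v = a(bv). As a reverses the order, bv < a^∞, so bv < a(bv) = v, hence b^∞ < v.
The hypothesis therefore compares b^∞ with v itself, not with a^∞ as in the positive case. -/
theorem le_of_sign_neg_one (ha : a ≠ []) (hb : b ≠ []) (hs : sign σ a = -1)
    (hva : prepend a va = va) (hvb : prepend b vb = vb) (hv : prepend (a ++ b) v = v)
    (h : v ≤ vb) : v ≤ va := by
  by_contra! hlt
  have h1 : prepend b v < va := by
    by_contra! h3
    have := (prepend_strictAnti (σ := σ) hs).antitone h3
    rw [prepend_prepend_of_append hv, hva] at this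
    exact this.not_gt hlt
  exact h.not_gt ((prepend_lt_iff hb hvb v).1 ((prepend_lt_self_iff_conj ha hva hv).2 h1))

theorem ge_of_sign_neg_one (ha : a ≠ []) (hb : b ≠ []) (hs : sign σ a = -1)
    (hva : prepend a va = va) (hvb : prepend b vb = vb) (hv : prepend (a ++ b) v = v)
    (h : vb ≤ v) : va ≤ v := by
  by_contra! hlt
  have h1 : va < prepend b v := by
    by_contra! h3
    have := (prepend_strictAnti (σ := σ) hs).antitone h3
    rw [prepend_prepend_of_append hv, hva] at this
    exact this.not_gt hlt
  exact h.not_gt ((lt_prepend_iff hb hvb v).1 ((self_lt_prepend_iff_conj ha hva hv).2 h1))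

/-- Since a and b commute, av is again fixed by ab, so av = v by uniqueness. -/
theorem eq_of_commute (ha : a ≠ []) (hva : prepend a va = va) (hv : prepend (a ++ b) v = v)
    (h : a ++ b = b ++ a) : v = va := by
  refine eq_of_prepend_eq_self ha ?_ hva
  refine eq_of_prepend_eq_self (p := a ++ b) (by simp [ha]) ?_ hv
  rw [h, prepend_append] at hv
  rw [prepend_append, hv]

end Products

end SignedWord

/-! ### Compatible words: order of suffixes and of their periodic words -/

open SignedWord

/-- The finite word `ζ = z₀ … z_{N-1}` is compatible with the relative order of the distinct
numbers `P 0, …, P N`: larger numbers have larger letters, and the sign of a common letter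
says how the successors of two numbers compare. -/
structure IsCompatible {k : ℕ} (σ : Fin k → ℤˣ) (ζ : List (Fin k)) (P : ℕ → ℕ) : Prop where
  inj : ∀ i j, i ≤ ζ.length → j ≤ ζ.length → P i = P j → i = j
  letter_le : ∀ i j (hi : i < ζ.length) (hj : j < ζ.length), P i < P j → ζ[i] ≤ ζ[j]
  next : ∀ i j (hi : i < ζ.length) (hj : j < ζ.length), ζ[i] = ζ[j] → P i < P j →
    (σ ζ[i] = 1 ∧ P (i + 1) < P (j + 1)) ∨ (σ ζ[i] = -1 ∧ P (j + 1) < P (i + 1))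

theorem lt_and_eq_of_drop_eq_cons {α : Type*} {ζ : List α} {i : ℕ} {t : α} {l : List α}
    (h : ζ.drop i = t :: l) : ∃ hi : i < ζ.length, ζ[i] = t ∧ ζ.drop (i + 1) = l := by
  have hi : i < ζ.length := by
    by_contra! hi
    simp [List.drop_eq_nil_of_le hi] at h
  rw [List.drop_eq_getElem_cons hi, List.cons.injEq] at h
  exact ⟨hi, h⟩

namespace IsCompatible

variable {k : ℕ} {σ : Fin k → ℤˣ} {ζ : List (Fin k)} {P : ℕ → ℕ}

/-- Both suffixes are read letter by letter until they differ or one ends; a common negative letter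
exchanges their roles. The bound d is on the total length left to read. -/
theorem prefix_or_lt_aux (h : IsCompatible σ ζ P) (d : ℕ) : ∀ i j,
    (ζ.length - i) + (ζ.length - j) ≤ d → i ≤ ζ.length → j ≤ ζ.length → P i < P j →
    (∃ b, ζ.drop i = ζ.drop j ++ b) ∨ (∃ b, ζ.drop j = ζ.drop i ++ b) ∨
      ∀ u u' : SignedWord σ, prepend (ζ.drop i) u < prepend (ζ.drop j) u' := by
  induction d with
  | zero =>
    intro i j hd hi hj hij
    exact .inr (.inl ⟨ζ.drop j, by simp [List.drop_eq_nil_of_le (show ζ.length ≤ i by omega)]⟩)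
  | succ d ih =>
    intro i j hd hi hj hij
    rcases hi.eq_or_lt with rfl | hi'
    · exact .inr (.inl ⟨ζ.drop j, by simp⟩)
    rcases hj.eq_or_lt with rfl | hj'
    · exact .inl ⟨ζ.drop i, by simp⟩
    rw [List.drop_eq_getElem_cons hi', List.drop_eq_getElem_cons hj']
    rcases (h.letter_le i j hi' hj' hij).lt_or_eq with hlt | heq
    · exact .inr (.inr fun u u' => cons_lt_cons_of_lt hlt _ _)
    · rw [← heq]
      rcases h.next i j hi' hj' heq hij with ⟨hs, hn⟩ | ⟨hs, hn⟩
      · rcases ih (i + 1) (j + 1) (by omega) (by omega) (by omega) hn with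
          ⟨b, hb⟩ | ⟨b, hb⟩ | H
        · exact .inl ⟨b, by rw [hb, List.cons_append]⟩
        · exact .inr (.inl ⟨b, by rw [hb, List.cons_append]⟩)
        · exact .inr (.inr fun u u' => cons_strictMono hs (H u u'))
      · rcases ih (j + 1) (i + 1) (by omega) (by omega) (by omega) hn with
          ⟨b, hb⟩ | ⟨b, hb⟩ | H
        · exact .inr (.inl ⟨b, by rw [hb, List.cons_append]⟩)
        · exact .inl ⟨b, by rw [hb, List.cons_append]⟩
        · exact .inr (.inr fun u u' => cons_strictAnti hs (H u' u))

/-- What remains of a suffix of ζ after a prefix is removed is again a suffix of ζ, so it has its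
own number and its own periodic word. -/
theorem drop_eq_drop_append_drop {i j : ℕ} (hi : i ≤ ζ.length) (hj : j ≤ ζ.length)
    {b : List (Fin k)} (h : ζ.drop i = ζ.drop j ++ b) :
    i ≤ j ∧ ζ.drop i = ζ.drop j ++ ζ.drop (i + (ζ.length - j)) := by
  have hlen := congrArg List.length h
  simp only [List.length_drop, List.length_append] at hlen
  refine ⟨by omega, ?_⟩
  have h2 := congrArg (List.drop (ζ.length - j)) h
  rw [List.drop_drop, List.drop_left' (by simp)] at h2
  rw [h2, h]

/-- Suffixes of a compatible word compare as the corresponding numbers, unless one of them is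
a prefix of the other. -/
theorem prefix_or_lt (h : IsCompatible σ ζ P) {i j : ℕ} (hi : i ≤ ζ.length) (hj : j ≤ ζ.length)
    (hij : P i < P j) :
    (i < j ∧ ζ.drop i = ζ.drop j ++ ζ.drop (i + (ζ.length - j))) ∨
    (j < i ∧ ζ.drop j = ζ.drop i ++ ζ.drop (j + (ζ.length - i))) ∨
      ∀ u u' : SignedWord σ, prepend (ζ.drop i) u < prepend (ζ.drop j) u' := by
  have hne : i ≠ j := fun h => hij.ne (h ▸ rfl)
  rcases h.prefix_or_lt_aux _ i j le_rfl hi hj hij with ⟨b, hb⟩ | ⟨b, hb⟩ | H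
  · obtain ⟨h1, h2⟩ := drop_eq_drop_append_drop hi hj hb
    exact .inl ⟨lt_of_le_of_ne h1 hne, h2⟩
  · obtain ⟨h1, h2⟩ := drop_eq_drop_append_drop hj hi hb
    exact .inr (.inl ⟨lt_of_le_of_ne h1 hne.symm, h2⟩)
  · exact .inr (.inr H)

/-- Deletion of a common prefix. -/
theorem strip (h : IsCompatible σ ζ P) (c : List (Fin k)) : ∀ i j,
    ζ.drop i = c ++ ζ.drop (i + c.length) → ζ.drop j = c ++ ζ.drop (j + c.length) →
    P i < P j →
    (sign σ c = 1 ∧ P (i + c.length) < P (j + c.length)) ∨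
      (sign σ c = -1 ∧ P (j + c.length) < P (i + c.length)) := by
  induction c with
  | nil => exact fun i j _ _ hij => .inl ⟨rfl, hij⟩
  | cons t c ih =>
    intro i j hi hj hij
    have e1 : ∀ i, i + (t :: c).length = i + 1 + c.length := fun i => by
      rw [List.length_cons]; omega
    rw [e1, List.cons_append] at hi hj
    rw [e1, e1, sign_cons]
    obtain ⟨hi1, hi2, hi3⟩ := lt_and_eq_of_drop_eq_cons hi
    obtain ⟨hj1, hj2, hj3⟩ := lt_and_eq_of_drop_eq_cons hj
    have := h.next i j hi1 hj1 (hi2.trans hj2.symm) hij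
    rw [hi2] at this
    rcases this with ⟨hs, hn⟩ | ⟨hs, hn⟩
    · simpa [hs] using ih _ _ hi3 hj3 hn
    · rcases ih _ _ hj3 hi3 hn with ⟨hs', hn'⟩ | ⟨hs', hn'⟩
      · exact .inr ⟨by rw [hs, hs', mul_one], hn'⟩
      · exact .inl ⟨by rw [hs, hs']; decide, hn'⟩

theorem strip_left (h : IsCompatible σ ζ P) {i j : ℕ} (hj : j ≤ ζ.length) (hij : P i < P j)
    (hp : ζ.drop i = ζ.drop j ++ ζ.drop (i + (ζ.length - j))) :
    (sign σ (ζ.drop j) = 1 ∧ P (i + (ζ.length - j)) < P ζ.length) ∨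
      (sign σ (ζ.drop j) = -1 ∧ P ζ.length < P (i + (ζ.length - j))) := by
  have e : j + (ζ.length - j) = ζ.length := by omega
  have := h.strip (ζ.drop j) i j (by rwa [List.length_drop]) (by simp [e]) hij
  rwa [List.length_drop, e] at this

theorem strip_right (h : IsCompatible σ ζ P) {i j : ℕ} (hi : i ≤ ζ.length) (hij : P i < P j)
    (hp : ζ.drop j = ζ.drop i ++ ζ.drop (j + (ζ.length - i))) :
    (sign σ (ζ.drop i) = 1 ∧ P ζ.length < P (j + (ζ.length - i))) ∨
      (sign σ (ζ.drop i) = -1 ∧ P (j + (ζ.length - i)) < P ζ.length) := by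
  have e : i + (ζ.length - i) = ζ.length := by omega
  have := h.strip (ζ.drop i) i j (by simp [e]) (by rwa [List.length_drop]) hij
  rwa [List.length_drop, e] at this

theorem drop_ne_nil {i : ℕ} (hi : i < ζ.length) : ζ.drop i ≠ [] := by
  simpa [List.drop_eq_nil_iff] using hi

/-- If `u` is in the correct position with respect to the periodic words of the suffixes of a
compatible word `ζ`, then the shifts of `ζ u` are in the prescribed order. -/
theorem prepend_lt_prepend (h : IsCompatible σ ζ P) {q : ℕ → SignedWord σ}
    (hq : ∀ i < ζ.length, prepend (ζ.drop i) (q i) = q i) {u : SignedWord σ}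
    (h1 : ∀ i < ζ.length, P i < P ζ.length → q i < u)
    (h2 : ∀ i < ζ.length, P ζ.length < P i → u < q i) {i j : ℕ}
    (hi : i ≤ ζ.length) (hj : j ≤ ζ.length) (hij : P i < P j) :
    prepend (ζ.drop i) u < prepend (ζ.drop j) u := by
  have lo : ∀ i < ζ.length, P i < P ζ.length → prepend (ζ.drop i) u < u := fun i hi h =>
    (prepend_lt_iff (drop_ne_nil hi) (hq i hi) u).2 (h1 i hi h)
  have up : ∀ i < ζ.length, P ζ.length < P i → u < prepend (ζ.drop i) u := fun i hi h =>
    (lt_prepend_iff (drop_ne_nil hi) (hq i hi) u).2 (h2 i hi h)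
  rcases h.prefix_or_lt hi hj hij with ⟨hlt, hp⟩ | ⟨hlt, hp⟩ | H
  -- As i < j, the remaining suffix is nonempty, so its comparison with u is governed by its
  -- periodic word.
  · have hi' : i + (ζ.length - j) < ζ.length := by omega
    rw [hp, prepend_append]
    rcases h.strip_left hj hij hp with ⟨hs, hn⟩ | ⟨hs, hn⟩
    · exact prepend_strictMono hs (lo _ hi' hn)
    · exact prepend_strictAnti hs (up _ hi' hn)
  · have hj' : j + (ζ.length - i) < ζ.length := by omega
    rw [hp, prepend_append]
    rcases h.strip_right hi hij hp with ⟨hs, hn⟩ | ⟨hs, hn⟩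
    · exact prepend_strictMono hs (up _ hj' hn)
    · exact prepend_strictAnti hs (lo _ hj' hn)
  · exact H u u

/-- The bounds allow `P i` to exceed `P ζ.length` by at most 1 and `P j` to fall short of it by at
most 1. This slack covers the pair y, x and keeps the induction closed. The only difficulty is a
suffix ab whose prefix a is the other suffix. If a is positive, the induction applies to b and a; if
negative, b is compared with the whole of ab. -/
theorem periodic_le (h : IsCompatible σ ζ P) {q : ℕ → SignedWord σ}
    (hq : ∀ i < ζ.length, prepend (ζ.drop i) (q i) = q i) (i j : ℕ)
    (hi : i < ζ.length) (hj : j < ζ.length) (hij : P i < P j) (hiN : P i ≤ P ζ.length + 1)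
    (hjN : P ζ.length ≤ P j + 1) : q i ≤ q j := by
  have direct : ∀ i j, i < ζ.length → j < ζ.length →
      (∀ u u' : SignedWord σ, prepend (ζ.drop i) u < prepend (ζ.drop j) u') → q i ≤ q j := by
    intro i j hi hj H
    rw [← hq i hi, ← hq j hj]
    exact (H _ _).le
  induction hd : ζ.length - min i j using Nat.strong_induction_on generalizing i j with
  | _ d ih =>
    subst hd
    rcases h.prefix_or_lt hi.le hj.le hij with ⟨hlt, hp⟩ | ⟨hlt, hp⟩ | H
    · obtain ⟨m, hm⟩ : ∃ m, m = i + (ζ.length - j) := ⟨_, rfl⟩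
      have hs := h.strip_left hj.le hij hp
      rw [← hm] at hp hs
      have hmN : m < ζ.length := by omega
      have hv := hq i hi
      rw [hp] at hv
      rcases hs with ⟨hs, hn⟩ | ⟨hs, hn⟩
      · refine le_of_sign_one (drop_ne_nil hj) (drop_ne_nil hmN) hs (hq j hj) (hq m hmN) hv ?_
        -- `P m < P ζ.length ≤ P j + 1` leaves only `m = j` or `P m < P j`.
        by_cases hmj : m = j
        · rw [hmj]
        have : P m ≠ P j := fun e => hmj (h.inj _ _ hmN.le hj.le e)
        exact ih _ (by omega) m j hmN hj (by omega) (by omega) hjN rfl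
      · have hne : P i ≠ P m := fun e => by have := h.inj _ _ hi.le hmN.le e; omega
        rcases h.prefix_or_lt hi.le hmN.le (show P i < P m by omega) with
          ⟨hlt', hp'⟩ | ⟨hlt', hp'⟩ | H
        -- The suffix is both ab and ba here, so the factors commute.
        · rw [show i + (ζ.length - m) = j by omega] at hp'
          exact (eq_of_commute (drop_ne_nil hj) (hq j hj) hv (hp.symm.trans hp')).le
        · omega
        · exact le_of_sign_neg_one (drop_ne_nil hj) (drop_ne_nil hmN) hs (hq j hj) (hq m hmN) hv
            (direct i m hi hmN H)
    · obtain ⟨m, hm⟩ : ∃ m, m = j + (ζ.length - i) := ⟨_, rfl⟩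
      have hs := h.strip_right hi.le hij hp
      rw [← hm] at hp hs
      have hmN : m < ζ.length := by omega
      have hv := hq j hj
      rw [hp] at hv
      rcases hs with ⟨hs, hn⟩ | ⟨hs, hn⟩
      · refine ge_of_sign_one (drop_ne_nil hi) (drop_ne_nil hmN) hs (hq i hi) (hq m hmN) hv ?_
        by_cases hmi : m = i
        · rw [hmi]
        have : P m ≠ P i := fun e => hmi (h.inj _ _ hmN.le hi.le e)
        exact ih _ (by omega) i m hi hmN (by omega) hiN (by omega) rfl
      · have hne : P j ≠ P m := fun e => by have := h.inj _ _ hj.le hmN.le e; omega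
        rcases h.prefix_or_lt hmN.le hj.le (show P m < P j by omega) with
          ⟨hlt', hp'⟩ | ⟨hlt', hp'⟩ | H
        · omega
        · rw [show j + (ζ.length - m) = i by omega] at hp'
          exact (eq_of_commute (drop_ne_nil hi) (hq i hi) hv (hp.symm.trans hp')).ge
        · exact ge_of_sign_neg_one (drop_ne_nil hi) (drop_ne_nil hmN) hs (hq i hi) (hq m hmN) hv
            (direct m j hmN hj H)
    · exact direct i j hi hj H

end IsCompatible

/-! ### Orbits of a monotone or antitone shift -/

/-- If the shift `r ↦ r + 1` is monotone or antitone on a sequence and terms with positive index are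
adjacent to `a 0` on both sides, then these are the first two terms. -/
theorem eq_one_two_of_order_rule (a : ℕ → ℤ) (M : ℕ)
    (h : (∀ r < M, ∀ s < M, a r < a s → a (r + 1) < a (s + 1)) ∨
      (∀ r < M, ∀ s < M, a r < a s → a (s + 1) < a (r + 1)))
    (inj : ∀ r ≤ M, ∀ s ≤ M, a r = a s → r = s) {r s : ℕ} (hr : 1 ≤ r) (hs : 1 ≤ s) (hrM : r ≤ M)
    (hsM : s ≤ M) (har : a r + 1 = a 0) (has : a s = a 0 + 1) (h10 : a 1 < a 0) :
    r = 1 ∧ s = 2 := by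
  have low : (∀ r, 1 ≤ r → r ≤ M → a r < a 0) → False := fun H => by
    have := H s hs hsM; omega
  rcases h with h | h
  -- A monotone shift that starts downwards stays below `a 0`, leaving no room for `a s`.
  · refine (low fun r hr => ?_).elim
    induction r, hr using Nat.le_induction with
    | base => exact fun _ => h10
    | succ r hr ih =>
      intro hrM
      exact (h r (by omega) 0 (by omega) (ih (by omega))).trans (by simpa using h10)
  · have hM : 2 ≤ M := by
      by_contra! hM
      obtain rfl : r = 1 := by omega
      obtain rfl : s = 1 := by omega
      omega
    have h21 : a 1 < a 2 := h 1 (by omega) 0 (by omega) h10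
    have h20 : a 2 ≠ a 0 := fun e => by simpa using inj 2 hM 0 (by omega) e
    rcases lt_or_gt_of_ne h20 with h20 | h20
    -- Spiralling inwards: once `a 2 < a 0`, all later terms stay below `a 0`.
    · refine (low fun r => ?_).elim
      induction r using Nat.strong_induction_on with
      | _ r ih =>
        intro hr hrM
        match r, hr with
        | 1, _ => exact h10
        | 2, _ => exact h20
        | r + 3, _ =>
          have h1 := ih (r + 1) (by omega) (by omega) (by omega)
          have h2 := h _ (by omega) _ (by omega) h1
          have h3 := h (0 + 1) (by omega) _ (by omega) h2
          exact h3.trans h20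
    -- Spiralling outwards: no later term falls strictly between `a 1` and `a 2`, so the two
    -- neighbours of `a 0` must be these.
    · have out : ∀ r, 1 ≤ r → r ≤ M → r = 1 ∨ a r < a 1 ∨ a 2 ≤ a r := by
        intro r hr
        induction r, hr using Nat.le_induction with
        | base => exact fun _ => .inl rfl
        | succ r hr ih =>
          intro hrM
          rcases ih (by omega) with rfl | h1 | h1
          · exact .inr (.inr le_rfl)
          · exact .inr (.inr (h r (by omega) 1 (by omega) h1).le)
          · exact .inr (.inl (h 0 (by omega) r (by omega) (h20.trans_le h1)))
      refine ⟨?_, ?_⟩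
      · rcases out r hr hrM with rfl | h1 | h1 <;> omega
      · apply inj s hsM 2 hM
        rcases out s hs hsM with rfl | h1 | h1 <;> omega

/-! ### The smallest and the largest word -/

namespace SignedWord

variable {k : ℕ} {σ : Fin k → ℤˣ}

theorem exists_append_of_prepend_eq {a : List (Fin k)} : ∀ {b : List (Fin k)}
    {u v : SignedWord σ}, a.length ≤ b.length → prepend a u = prepend b v →
    ∃ b', b = a ++ b' ∧ u = prepend b' v := by
  induction a with
  | nil => exact fun {b u v} _ h => ⟨b, rfl, h⟩
  | cons t a ih =>
    intro b u v hl h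
    cases b with
    | nil => simp at hl
    | cons s b =>
      obtain ⟨b', rfl, h'⟩ := ih (by simpa using hl) (congrArg (signedShift σ) h)
      have h0 : t = s := congrFun h 0
      exact ⟨b', by rw [h0, List.cons_append], h'⟩

/-- The smallest (for `false`) or largest (for `true`) letter. -/
def extremeLetter (hk : 2 ≤ k) : Bool → Fin k
  | false => ⟨0, by omega⟩
  | true => ⟨k - 1, by omega⟩

theorem extremeLetter_not_ne (hk : 2 ≤ k) (b : Bool) :
    extremeLetter hk (!b) ≠ extremeLetter hk b := by
  cases b <;> simp [extremeLetter] <;> omega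

/-- The letters of the smallest and of the largest word. -/
def extremeAt (hk : 2 ≤ k) (σ : Fin k → ℤˣ) : ℕ → Bool → Fin k
  | 0, b => extremeLetter hk b
  | i + 1, b => extremeAt hk σ i (if σ (extremeLetter hk b) = 1 then b else !b)

/-- The smallest (for `false`) or largest (for `true`) word. -/
def extreme (hk : 2 ≤ k) (σ : Fin k → ℤˣ) (b : Bool) : SignedWord σ :=
  fun i => extremeAt hk σ i b

theorem shift_extreme_pos (hk : 2 ≤ k) {b : Bool} (h : σ (extremeLetter hk b) = 1) :
    signedShift σ (extreme hk σ b) = extreme hk σ b := by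
  funext i
  simp [signedShift, extreme, extremeAt, h]

theorem shift_extreme_neg (hk : 2 ≤ k) {b : Bool} (h : σ (extremeLetter hk b) = -1) :
    signedShift σ (extreme hk σ b) = extreme hk σ (!b) := by
  funext i
  have h' : ¬ (-1 : ℤˣ) = 1 := by decide
  simp [signedShift, extreme, extremeAt, h, h']

theorem ne_extreme_of_lt (hk : 2 ≤ k) {v w : SignedWord σ} (h : v < w) :
    w ≠ extreme hk σ false ∧ v ≠ extreme hk σ true := by
  have h' : SignedLess σ v w := h
  clear h
  induction h' with
  | @first v w h =>
    refine ⟨?_, ?_⟩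
    · rintro rfl
      have : (v 0 : ℕ) < 0 := h
      omega
    · rintro rfl
      have : k - 1 < (w 0 : ℕ) := h
      omega
  | @pos v w h hs _ ih =>
    refine ⟨?_, ?_⟩
    · rintro rfl
      rw [h] at hs
      exact ih.1 (shift_extreme_pos hk hs)
    · rintro rfl
      exact ih.2 (shift_extreme_pos hk hs)
  | @neg v w h hs _ ih =>
    refine ⟨?_, ?_⟩
    · rintro rfl
      rw [h] at hs
      exact ih.2 (shift_extreme_neg hk hs)
    · rintro rfl
      exact ih.1 (shift_extreme_neg hk hs)

theorem extreme_false_lt (hk : 2 ≤ k) {w : SignedWord σ} (h : w ≠ extreme hk σ false) :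
    extreme hk σ false < w :=
  (lt_or_gt_of_ne h).resolve_left fun h' => (ne_extreme_of_lt hk h').1 rfl

theorem lt_extreme_true (hk : 2 ≤ k) {w : SignedWord σ} (h : w ≠ extreme hk σ true) :
    w < extreme hk σ true :=
  (lt_or_gt_of_ne h).resolve_right fun h' => (ne_extreme_of_lt hk h').2 rfl

theorem prepend_single_extreme (hk : 2 ≤ k) {b : Bool} (h : σ (extremeLetter hk b) = 1) :
    prepend [extremeLetter hk b] (extreme hk σ b) = extreme hk σ b := by
  conv_rhs => rw [← cons_shift (extreme hk σ b), shift_extreme_pos hk h]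
  rfl

theorem prepend_pair_extreme (hk : 2 ≤ k) {b : Bool} (h : σ (extremeLetter hk b) = -1)
    (h' : σ (extremeLetter hk (!b)) = -1) :
    prepend [extremeLetter hk b, extremeLetter hk (!b)] (extreme hk σ b) = extreme hk σ b := by
  conv_rhs => rw [← cons_shift (extreme hk σ b), shift_extreme_neg hk h,
    ← cons_shift (extreme hk σ (!b)), shift_extreme_neg hk h', Bool.not_not]
  rfl

theorem extreme_apply_of_pos (hk : 2 ≤ k) {b : Bool} (h : σ (extremeLetter hk b) = 1) (i : ℕ) :
    extreme hk σ b i = extremeLetter hk b := by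
  induction i with
  | zero => rfl
  | succ i ih => rw [← ih]; exact congrFun (shift_extreme_pos hk h) i

theorem extreme_apply_of_neg (hk : 2 ≤ k) {b : Bool} (h : σ (extremeLetter hk b) = -1)
    (h' : σ (extremeLetter hk (!b)) = -1) (i : ℕ) :
    extreme hk σ b (2 * i) = extremeLetter hk b ∧
      extreme hk σ b (2 * i + 1) = extremeLetter hk (!b) := by
  have e : ∀ i, extreme hk σ b (i + 2) = extreme hk σ b i := fun i => by
    have h1 : extreme hk σ b (i + 2) = extreme hk σ (!b) (i + 1) :=
      congrFun (shift_extreme_neg hk h) (i + 1)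
    have h2 : extreme hk σ (!b) (i + 1) = extreme hk σ (!!b) i :=
      congrFun (shift_extreme_neg hk h') i
    rw [h1, h2, Bool.not_not]
  induction i with
  | zero => exact ⟨rfl, congrFun (shift_extreme_neg hk h) 0⟩
  | succ i ih => exact ⟨(e _).trans ih.1, (e _).trans ih.2⟩

theorem getElem_of_prepend_drop {ζ : List (Fin k)} {i : ℕ} {v : SignedWord σ}
    (hv : prepend (ζ.drop i) v = v) {m : ℕ} (him : i ≤ m) (hm : m < ζ.length) :
    ζ[m] = v (m - i) := by
  rw [← hv, prepend_apply_lt _ _ _ (by rw [List.length_drop]; omega), List.getElem_drop]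
  congr 1
  omega

theorem apply_of_prepend_drop {ζ : List (Fin k)} {i : ℕ} {v : SignedWord σ}
    (hv : prepend (ζ.drop i) v = v) : v (ζ.length - i) = v 0 := by
  have := prepend_apply_add (ζ.drop i) v 0
  rwa [hv, List.length_drop, Nat.add_zero] at this

/-- An extreme word can be purely periodic in two ways only: constant, or alternating between the
two extreme letters. The end of the period shows which. -/
theorem last_letters_of_extreme_periodic (hk : 2 ≤ k) {ζ : List (Fin k)} {i : ℕ}
    (hi : i < ζ.length) {b : Bool} (hv : prepend (ζ.drop i) (extreme hk σ b) = extreme hk σ b) :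
    (σ (extremeLetter hk b) = 1 ∧ ζ[ζ.length - 1] = extremeLetter hk b) ∨
      (σ (extremeLetter hk b) = -1 ∧ σ (extremeLetter hk (!b)) = -1 ∧ 2 ≤ ζ.length ∧
        ζ[ζ.length - 1] = extremeLetter hk (!b) ∧ ζ[ζ.length - 2] = extremeLetter hk b) := by
  have h0 : extreme hk σ b (ζ.length - i) = extremeLetter hk b := apply_of_prepend_drop hv
  rcases Int.units_eq_one_or (σ (extremeLetter hk b)) with h | h
  · refine .inl ⟨h, ?_⟩
    rw [getElem_of_prepend_drop hv (by omega), extreme_apply_of_pos hk h]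
  · right
    rcases Int.units_eq_one_or (σ (extremeLetter hk (!b))) with h' | h'
    -- With mixed signs the word is one extreme letter followed by the other one forever, so its
    -- first letter never returns.
    · refine (extremeLetter_not_ne hk b ?_).elim
      rw [← h0, ← extreme_apply_of_pos hk h' (ζ.length - i - 1), ← shift_extreme_neg hk h,
        signedShift]
      congr 1
      omega
    · rcases Nat.even_or_odd' (ζ.length - i) with ⟨m, hm | hm⟩
      · obtain ⟨l, rfl⟩ : ∃ l, m = l + 1 := ⟨m - 1, by omega⟩
        refine ⟨h, h', by omega, ?_, ?_⟩
        · rw [getElem_of_prepend_drop hv (by omega),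
            show ζ.length - 1 - i = 2 * l + 1 by omega, (extreme_apply_of_neg hk h h' l).2]
        · rw [getElem_of_prepend_drop hv (by omega),
            show ζ.length - 2 - i = 2 * l by omega, (extreme_apply_of_neg hk h h' l).1]
      · rw [hm, (extreme_apply_of_neg hk h h' m).2] at h0
        exact (extremeLetter_not_ne hk b h0).elim

end SignedWord

/-! ### Coinciding periodic words, and the tail when π_n is not extreme -/

namespace IsCompatible

variable {k : ℕ} {σ : Fin k → ℤˣ} {ζ : List (Fin k)} {P : ℕ → ℕ}

/-- All suffixes of `ζ` with the same periodic word are powers of the shortest one. -/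
theorem exists_root {q : ℕ → SignedWord σ} (hq : ∀ i < ζ.length, prepend (ζ.drop i) (q i) = q i)
    {x : ℕ} (hx : x < ζ.length) :
    ∃ d < ζ.length, ∀ i < ζ.length, q i = q x → ∃ M, 1 ≤ M ∧ ζ.length - i = M * (ζ.length - d) ∧
      ∀ r < M, ζ.drop (ζ.length - (r + 1) * (ζ.length - d)) =
        ζ.drop d ++ ζ.drop (ζ.length - r * (ζ.length - d)) := by
  classical
  -- The largest index d gives the shortest suffix, which serves as the common root.
  obtain ⟨d, hd, hmax⟩ := Finset.exists_max_image
    ((Finset.range ζ.length).filter fun i => q i = q x) id ⟨x, by simp [hx]⟩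
  simp only [Finset.mem_filter, Finset.mem_range, id] at hd hmax
  obtain ⟨hdN, hqd⟩ := hd
  refine ⟨d, hdN, fun i => ?_⟩
  induction hn : ζ.length - i using Nat.strong_induction_on generalizing i with
  | _ n ih =>
    subst hn
    intro hi hqi
    rcases (hmax i ⟨hi, hqi⟩).eq_or_lt with rfl | hlt
    · refine ⟨1, le_rfl, by simp, fun r hr => ?_⟩
      obtain rfl : r = 0 := by omega
      simp [show ζ.length - (ζ.length - i) = i by omega]
    · have h1 := hq i hi
      have h2 := hq d hdN
      rw [hqi] at h1
      rw [hqd] at h2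
      obtain ⟨b, hb, hb'⟩ := exists_append_of_prepend_eq
        (by rw [List.length_drop, List.length_drop]; omega) (h2.trans h1.symm)
      obtain ⟨-, hb2⟩ := drop_eq_drop_append_drop hi.le hdN.le hb
      rw [hb2, List.append_cancel_left_eq] at hb
      obtain ⟨m, hm⟩ : ∃ m, m = i + (ζ.length - d) := ⟨_, rfl⟩
      rw [← hm] at hb hb2
      rw [← hb] at hb'
      have hmN : m < ζ.length := by omega
      obtain ⟨M, hM, hMl, H⟩ := ih _ (by omega) m rfl hmN
        (eq_of_prepend_eq_self (drop_ne_nil hmN) (hq m hmN) hb'.symm)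
      have e : ζ.length - i = (M + 1) * (ζ.length - d) := by rw [add_mul, ← hMl]; omega
      refine ⟨M + 1, by omega, e, fun r hr => ?_⟩
      rcases (Nat.lt_succ_iff.1 hr).eq_or_lt with rfl | hr'
      · rw [← e, ← hMl, show ζ.length - (ζ.length - i) = i by omega,
          show ζ.length - (ζ.length - m) = m by omega, hb2]
      · exact H r hr'

/-- Both suffixes are powers of a root ρ. The numbers attached to ρ^0, ρ^1, … form an orbit under a
monotone or antitone shift, and x and y are the two neighbours of its initial term, so their
exponents are 1 and 2. -/
theorem eq_append_self_of_periodic_eq (h : IsCompatible σ ζ P) {q : ℕ → SignedWord σ}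
    (hq : ∀ i < ζ.length, prepend (ζ.drop i) (q i) = q i) {x y : ℕ} (hx : x < ζ.length)
    (hy : y < ζ.length) (hPx : P x = P ζ.length + 1) (hPy : P y + 1 = P ζ.length)
    (hxy : q y = q x) :
    ζ.drop x = ζ.drop y ++ ζ.drop y ∨ ζ.drop y = ζ.drop x ++ ζ.drop x := by
  obtain ⟨d, hd, H⟩ := exists_root hq hx
  obtain ⟨X, hX, hXl, HX⟩ := H x hx rfl
  obtain ⟨Y, hY, hYl, HY⟩ := H y hy hxy
  obtain ⟨M, hM⟩ : ∃ M, M = max X Y := ⟨_, rfl⟩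
  obtain ⟨l, hl⟩ : ∃ l, l = ζ.length - d := ⟨_, rfl⟩
  rw [← hl] at HX HY hXl hYl
  have hl0 : 0 < l := by omega
  have hMl : M * l ≤ ζ.length := by
    rcases max_choice X Y with e | e <;> rw [hM, e] <;> omega
  have HM : ∀ r < M, ζ.drop (ζ.length - (r + 1) * l) = ζ.drop d ++ ζ.drop (ζ.length - r * l) := by
    intro r hr
    rcases lt_max_iff.1 (hM ▸ hr) with hr | hr
    · exact HX r hr
    · exact HY r hr
  have hle : ∀ r ≤ M, r * l ≤ ζ.length := fun r hr => (Nat.mul_le_mul_right l hr).trans hMl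
  have inj : ∀ r ≤ M, ∀ s ≤ M, P (ζ.length - r * l) = P (ζ.length - s * l) → r = s := by
    intro r hr s hs e
    have h1 := h.inj _ _ (by omega) (by omega) e
    have h2 := hle r hr
    have h3 := hle s hs
    exact Nat.eq_of_mul_eq_mul_right hl0 (by omega)
  have rule : ∀ r < M, ∀ s < M,
      P (ζ.length - (r + 1) * l) < P (ζ.length - (s + 1) * l) →
      (sign σ (ζ.drop d) = 1 ∧ P (ζ.length - r * l) < P (ζ.length - s * l)) ∨
        (sign σ (ζ.drop d) = -1 ∧ P (ζ.length - s * l) < P (ζ.length - r * l)) := by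
    have e : ∀ r < M, ζ.length - (r + 1) * l + (ζ.drop d).length = ζ.length - r * l := by
      intro r hr
      have h1 := hle (r + 1) (by omega)
      rw [add_mul, one_mul] at h1 ⊢
      rw [List.length_drop]
      omega
    intro r hr s hs hlt
    have := h.strip (ζ.drop d) _ _ (by rw [e r hr, HM r hr]) (by rw [e s hs, HM s hs]) hlt
    rwa [e r hr, e s hs] at this
  -- Deleting ρ lowers the exponent; distinctness of the numbers lets the implication be turned
  -- round to raise it.
  have rule' : (∀ r < M, ∀ s < M, P (ζ.length - r * l) < P (ζ.length - s * l) →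
        P (ζ.length - (r + 1) * l) < P (ζ.length - (s + 1) * l)) ∨
      (∀ r < M, ∀ s < M, P (ζ.length - r * l) < P (ζ.length - s * l) →
        P (ζ.length - (s + 1) * l) < P (ζ.length - (r + 1) * l)) := by
    rcases Int.units_eq_one_or (sign σ (ζ.drop d)) with hs | hs
    · refine .inl fun r hr s hs' hlt => ?_
      by_contra! hge
      rcases hge.eq_or_lt with e | hgt
      · have := inj _ (by omega) _ (by omega) e
        obtain rfl : s = r := by omega
        omega
      · rcases rule s hs' r hr hgt with ⟨_, h1⟩ | ⟨h1, _⟩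
        · omega
        · rw [hs] at h1
          exact absurd h1 (by decide)
    · refine .inr fun r hr s hs' hlt => ?_
      by_contra! hge
      rcases hge.eq_or_lt with e | hgt
      · have := inj _ (by omega) _ (by omega) e
        obtain rfl : s = r := by omega
        omega
      · rcases rule r hr s hs' hgt with ⟨h1, _⟩ | ⟨_, h1⟩
        · rw [hs] at h1
          exact absurd h1 (by decide)
        · omega
  have ex : ζ.length - X * l = x := by omega
  have ey : ζ.length - Y * l = y := by omega
  have h1M : 1 ≤ M := hX.trans (hM ▸ le_max_left X Y)
  have hX' : X ≤ M := hM ▸ le_max_left X Y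
  have hY' : Y ≤ M := hM ▸ le_max_right X Y
  have d1 : ζ.drop (ζ.length - 1 * l) = ζ.drop d := by
    simpa using HM 0 (by omega)
  have d2 : 2 ≤ M → ζ.drop (ζ.length - 2 * l) = ζ.drop d ++ ζ.drop d := fun h2 => by
    rw [HM 1 (by omega), d1]
  have h10 : P (ζ.length - 1 * l) ≠ P (ζ.length - 0 * l) := fun e => by
    simpa using inj 1 h1M 0 (by omega) e
  rcases lt_or_gt_of_ne h10 with h10 | h10
  · obtain ⟨rfl, rfl⟩ := eq_one_two_of_order_rule (fun r => (P (ζ.length - r * l) : ℤ)) M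
      (by simpa only [Nat.cast_lt] using rule') (by simpa only [Nat.cast_inj] using inj)
      hY hX hY' hX' (by simp only [ey]; simp; omega) (by simp only [ex]; simp; omega)
      (by simpa using h10)
    left
    rw [← ex, ← ey, d1, d2 hX']
  -- Negating the numbers reduces an upward first move to a downward one and exchanges x with y.
  · obtain ⟨rfl, rfl⟩ := eq_one_two_of_order_rule (fun r => -(P (ζ.length - r * l) : ℤ)) M
      (by
        simp only [neg_lt_neg_iff, Nat.cast_lt]
        exact rule'.imp (fun h r hr s hs => h s hs r hr) (fun h r hr s hs => h s hs r hr))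
      (by simpa only [neg_inj, Nat.cast_inj] using inj)
      hX hY hX' hY' (by simp only [ex]; simp; omega) (by simp only [ey]; simp; omega)
      (by simpa using h10)
    right
    rw [← ex, ← ey, d1, d2 hY']

theorem exists_tail_of_middle (h : IsCompatible σ ζ P) {q : ℕ → SignedWord σ}
    (hq : ∀ i < ζ.length, prepend (ζ.drop i) (q i) = q i) {x y : ℕ} (hx : x < ζ.length)
    (hy : y < ζ.length) (hPx : P x = P ζ.length + 1) (hPy : P y + 1 = P ζ.length)
    (hv : ¬ (ζ.drop x = ζ.drop y ++ ζ.drop y ∨ ζ.drop y = ζ.drop x ++ ζ.drop x)) :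
    ∃ u, (∀ i < ζ.length, P i < P ζ.length → q i < u) ∧
      (∀ i < ζ.length, P ζ.length < P i → u < q i) := by
  have hyx : q y < q x :=
    lt_of_le_of_ne (h.periodic_le hq y x hy hx (by omega) (by omega) (by omega))
      fun e => hv (h.eq_append_self_of_periodic_eq hq hx hy hPx hPy e)
  obtain ⟨u, h1, h2⟩ := exists_between_periodic (drop_ne_nil hy) (hq y hy) hyx
  refine ⟨u, fun i hi hlt => ?_, fun i hi hlt => ?_⟩
  · refine lt_of_le_of_lt ?_ h1
    by_cases hiy : i = y
    · rw [hiy]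
    have : P i ≠ P y := fun e => hiy (h.inj _ _ hi.le hy.le e)
    exact h.periodic_le hq i y hi hy (by omega) (by omega) (by omega)
  · refine lt_of_lt_of_le h2 ?_
    by_cases hix : i = x
    · rw [hix]
    have : P i ≠ P x := fun e => hix (h.inj _ _ hi.le hx.le e)
    exact h.periodic_le hq x i hx hi (by omega) (by omega) (by omega)

end IsCompatible

/-! ### One-line notation and the marked cycle -/

/-- The one-line notation of `π` as a function on natural numbers. -/
def oneLine {n : ℕ} (π : Equiv.Perm (Fin n)) (i : ℕ) : ℕ :=
  if h : i < n then (π ⟨i, h⟩ : ℕ) else 0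

section OneLine

variable {n : ℕ} (π : Equiv.Perm (Fin n))

theorem oneLine_of_lt {i : ℕ} (h : i < n) : oneLine π i = (π ⟨i, h⟩ : ℕ) :=
  dif_pos h

theorem oneLine_lt {i : ℕ} (h : i < n) : oneLine π i < n := by
  rw [oneLine_of_lt π h]
  exact (π ⟨i, h⟩).isLt

theorem oneLine_inj {i j : ℕ} (hi : i < n) (hj : j < n) (h : oneLine π i = oneLine π j) :
    i = j := by
  rw [oneLine_of_lt π hi, oneLine_of_lt π hj] at h
  simpa using π.injective (Fin.ext h)

theorem exists_oneLine_eq {v : ℕ} (hv : v < n) : ∃ i < n, oneLine π i = v := by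
  refine ⟨π.symm ⟨v, hv⟩, (π.symm ⟨v, hv⟩).isLt, ?_⟩
  rw [oneLine_of_lt π (π.symm ⟨v, hv⟩).isLt]
  simp

theorem markedCycle_eq_some_iff {j v : Fin n} : markedCycle π j = some v ↔
    ∃ i, i + 1 < n ∧ oneLine π i = j ∧ oneLine π (i + 1) = v := by
  unfold markedCycle
  constructor
  · intro h
    split_ifs at h with hlt
    refine ⟨π.symm j, hlt, ?_, ?_⟩
    · rw [oneLine_of_lt π (π.symm j).isLt]
      simp
    · rw [oneLine_of_lt π hlt, Option.some.inj h]
  · rintro ⟨i, hi, h1, h2⟩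
    rw [oneLine_of_lt π (by omega)] at h1
    rw [oneLine_of_lt π hi] at h2
    have e1 : π ⟨i, Nat.lt_of_succ_lt hi⟩ = j := Fin.ext h1
    have e2 : π ⟨i + 1, hi⟩ = v := Fin.ext h2
    subst e1 e2
    simp [hi]

theorem markedCycle_eq_none_iff {j : Fin n} : markedCycle π j = none ↔
    oneLine π (n - 1) = j := by
  unfold markedCycle
  have hn := j.pos
  rw [oneLine_of_lt π (show n - 1 < n by omega), ← Fin.ext_iff, ← Equiv.eq_symm_apply, Fin.ext_iff]
  have := (π.symm j).isLt
  simp only [dite_eq_right_iff, reduceCtorEq, imp_false]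
  omega

theorem entryStar_iff (hn : 1 ≤ n) {j : ℕ} :
    EntryStar (markedCycle π) j ↔ oneLine π (n - 1) + 1 = j := by
  simp only [EntryStar, markedCycle_eq_none_iff]
  constructor
  · rintro ⟨i, rfl, h⟩
    rw [h]
  · rintro rfl
    exact ⟨⟨_, oneLine_lt π (show n - 1 < n by omega)⟩, rfl, rfl⟩

theorem entryEq_iff {j u : ℕ} : EntryEq (markedCycle π) j u ↔
    ∃ i, i + 1 < n ∧ oneLine π i + 1 = j ∧ oneLine π (i + 1) + 1 = u := by
  simp only [EntryEq, markedCycle_eq_some_iff]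
  constructor
  · rintro ⟨j, v, rfl, rfl, i, hi, h1, h2⟩
    exact ⟨i, hi, by rw [h1], by rw [h2]⟩
  · rintro ⟨i, hi, rfl, rfl⟩
    exact ⟨⟨_, oneLine_lt π (show i < n by omega)⟩, ⟨_, oneLine_lt π hi⟩, rfl, rfl, i, hi, rfl, rfl⟩

end OneLine

/-! ### From a valid segmentation to a word -/

namespace Segmentation

variable {k n : ℕ} {hk : 2 ≤ k} {hn : 1 ≤ n} {σ : Fin k → ℤˣ} {π : Equiv.Perm (Fin n)}
  (E : Segmentation hk hn σ π)

@[simp] theorem length_word : E.word.length = n - 1 := by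
  simp [word]

theorem getElem_word_bounds {i : ℕ} (hi : i < E.word.length) :
    E.e E.word[i].castSucc ≤ oneLine π i ∧ oneLine π i < E.e E.word[i].succ := by
  have hi' : i < n - 1 := by rwa [length_word] at hi
  have h : E.word[i] = E.letter ⟨i, by omega⟩ := by simp [word]
  have := (E.exists_letter ⟨i, by omega⟩).choose_spec
  rw [oneLine_of_lt π (show i < n by omega), h, letter]
  omega

theorem isCompatible_word : IsCompatible σ E.word (oneLine π) where
  inj i j hi hj h := oneLine_inj π (by rw [length_word] at hi; omega)
    (by rw [length_word] at hj; omega) h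
  letter_le i j hi hj hlt := by
    by_contra! hl
    have h1 := (E.getElem_word_bounds hj).2
    have h2 := (E.getElem_word_bounds hi).1
    have h3 : E.e E.word[j].succ ≤ E.e E.word[i].castSucc := E.mono (by
      rw [Fin.le_def, Fin.val_succ, Fin.val_castSucc]
      exact hl)
    omega
  next i j hi hj hij hlt := by
    have hi' : i + 1 < n := by rw [length_word] at hi; omega
    have hj' : j + 1 < n := by rw [length_word] at hj; omega
    have h1 := (E.getElem_word_bounds hi).1
    have h2 := (E.getElem_word_bounds hj).2
    rw [← hij] at h2
    have hP : ∀ i (hi : i + 1 < n), markedCycle π ⟨oneLine π i, oneLine_lt π (by omega)⟩ =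
        some ⟨oneLine π (i + 1), oneLine_lt π hi⟩ := fun i hi =>
      (markedCycle_eq_some_iff π).2 ⟨i, hi, rfl, rfl⟩
    rcases Int.units_eq_one_or (σ E.word[i]) with hs | hs
    · exact .inl ⟨hs, E.increasing _ hs _ _ h1 hlt h2 _ _ (hP i hi') (hP j hj')⟩
    · exact .inr ⟨hs, E.decreasing _ hs _ _ h1 hlt h2 _ _ (hP i hi') (hP j hj')⟩

/-- Such a period ends in 0, or in 0 followed by k-1. As nothing is smaller than π_n, the last
entries of π are then forced, and they trigger condition (b) or (e), whose conclusion forbids the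
letters just found. -/
theorem not_periodic_min {i : ℕ} (hi : i < E.word.length) (h0 : oneLine π (n - 1) = 0) :
    prepend (E.word.drop i) (extreme hk σ false) ≠ extreme hk σ false := by
  intro hv
  have hc := E.isCompatible_word
  have hN := E.length_word
  have ne0 : ∀ j < n - 1, oneLine π j ≠ 0 := fun j hj e => by
    have := oneLine_inj π (i := j) (j := n - 1) (by omega) (by omega) (by omega)
    omega
  have hstar : EntryStar (markedCycle π) 1 := (entryStar_iff π hn).2 (by omega)
  obtain ⟨x, hx, hx1⟩ := exists_oneLine_eq π (show 1 < n by omega)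
  have hxN : x ≠ n - 1 := by rintro rfl; omega
  have eN : E.word.length - 1 + 1 = n - 1 := by omega
  have hmin : ∀ t : Fin k, t ≤ extremeLetter hk false → t = extremeLetter hk false := fun t ht =>
    Fin.ext (Nat.le_zero.1 ht)
  rcases last_letters_of_extreme_periodic hk hi hv with ⟨hs, hl⟩ | ⟨hs, hs', h2, hl, hl'⟩
  -- Otherwise the smaller entry 1 (counted from 0) would also carry the increasing letter 0, and
  -- its successor would be smaller than the minimum π_n.
  · have hlast : oneLine π (E.word.length - 1) = 1 := by
      by_contra hne
      have hlt : oneLine π x < oneLine π (E.word.length - 1) := by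
        have := ne0 (E.word.length - 1) (by omega)
        omega
      have hle := hc.letter_le x (E.word.length - 1) (by omega) (by omega) hlt
      rw [hl] at hle
      have heq := hmin _ hle
      rcases hc.next x (E.word.length - 1) (by omega) (by omega) (heq.trans hl.symm) hlt with
        ⟨_, h⟩ | ⟨h, _⟩
      · rw [eN] at h
        omega
      · rw [heq, hs] at h
        exact absurd h (by decide)
    have he := E.cond_b hs hstar ((entryEq_iff π).2
      ⟨E.word.length - 1, by omega, by rw [hlast], by rw [eN, h0]⟩)
    have hb := (E.getElem_word_bounds (i := E.word.length - 1) (by omega)).2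
    rw [hl] at hb
    exact absurd (he ▸ hb : _ < 0) (by omega)
  · have eN' : E.word.length - 2 + 1 = E.word.length - 1 := by omega
    have hlast : oneLine π (E.word.length - 1) = n - 1 := by
      by_contra hne
      obtain ⟨y, hy, hy1⟩ := exists_oneLine_eq π (show n - 1 < n by omega)
      have hyN : y ≠ n - 1 := by rintro rfl; omega
      have hlt : oneLine π (E.word.length - 1) < oneLine π y := by
        have := oneLine_lt π (show E.word.length - 1 < n by omega)
        omega
      have hle := hc.letter_le (E.word.length - 1) y (by omega) (by omega) hlt
      rw [hl] at hle
      have heq : E.word[y]'(by omega) = extremeLetter hk true :=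
        le_antisymm (Nat.le_sub_one_of_lt (Fin.isLt _)) hle
      rcases hc.next (E.word.length - 1) y (by omega) (by omega) (hl.trans heq.symm) hlt with
        ⟨h, _⟩ | ⟨_, h⟩
      · rw [hl, hs'] at h
        exact absurd h (by decide)
      · rw [eN] at h
        omega
    have hprev : oneLine π (E.word.length - 2) = 1 := by
      by_contra hne
      have hlt : oneLine π x < oneLine π (E.word.length - 2) := by
        have := ne0 (E.word.length - 2) (by omega)
        omega
      have hle := hc.letter_le x (E.word.length - 2) (by omega) (by omega) hlt
      rw [hl'] at hle
      have heq := hmin _ hle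
      rcases hc.next x (E.word.length - 2) (by omega) (by omega) (heq.trans hl'.symm) hlt with
        ⟨h, _⟩ | ⟨_, h⟩
      · rw [heq, hs] at h
        exact absurd h (by decide)
      · rw [eN'] at h
        have := oneLine_lt π (show x + 1 < n by omega)
        omega
    have hb := (E.getElem_word_bounds (i := E.word.length - 2) (by omega)).2
    have hb' := (E.getElem_word_bounds (i := E.word.length - 1) (by omega)).1
    rw [hl'] at hb
    rw [hl] at hb'
    rcases E.cond_e hs hs' hstar ((entryEq_iff π).2
        ⟨E.word.length - 2, by omega, by rw [hprev], by rw [eN', hlast]; omega⟩)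
      ((entryEq_iff π).2 ⟨E.word.length - 1, by omega, by rw [hlast]; omega, by rw [eN, h0]⟩)
      with he | he
    · exact absurd (he ▸ hb : _ < 0) (by omega)
    · have : n ≤ oneLine π (E.word.length - 1) := he.symm.le.trans hb'
      omega

/-- The mirror image of `not_periodic_min`, using conditions (c) and (d). -/
theorem not_periodic_max {i : ℕ} (hi : i < E.word.length) (h0 : oneLine π (n - 1) = n - 1) :
    prepend (E.word.drop i) (extreme hk σ true) ≠ extreme hk σ true := by
  intro hv
  have hc := E.isCompatible_word
  have hN := E.length_word
  have ltN : ∀ j < n - 1, oneLine π j < n - 1 := fun j hj => by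
    have h1 := oneLine_lt π (show j < n by omega)
    have h2 : oneLine π j ≠ n - 1 := fun e => by
      have := oneLine_inj π (i := j) (j := n - 1) (by omega) (by omega) (by omega)
      omega
    omega
  have hstar : EntryStar (markedCycle π) n := (entryStar_iff π hn).2 (by omega)
  obtain ⟨x, hx, hx1⟩ := exists_oneLine_eq π (show n - 2 < n by omega)
  have hxN : x ≠ n - 1 := by rintro rfl; omega
  have eN : E.word.length - 1 + 1 = n - 1 := by omega
  have hmax : ∀ t : Fin k, extremeLetter hk true ≤ t → t = extremeLetter hk true := fun t ht =>
    le_antisymm (Nat.le_sub_one_of_lt (Fin.isLt _)) ht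
  rcases last_letters_of_extreme_periodic hk hi hv with ⟨hs, hl⟩ | ⟨hs, hs', h2, hl, hl'⟩
  · have hlast : oneLine π (E.word.length - 1) = n - 2 := by
      by_contra hne
      have hlt : oneLine π (E.word.length - 1) < oneLine π x := by
        have := ltN (E.word.length - 1) (by omega)
        omega
      have hle := hc.letter_le (E.word.length - 1) x (by omega) (by omega) hlt
      rw [hl] at hle
      have heq := hmax _ hle
      rcases hc.next (E.word.length - 1) x (by omega) (by omega) (hl.trans heq.symm) hlt with
        ⟨_, h⟩ | ⟨h, _⟩
      · rw [eN] at h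
        have := oneLine_lt π (show x + 1 < n by omega)
        omega
      · rw [hl, hs] at h
        exact absurd h (by decide)
    have he := E.cond_c hs ((entryEq_iff π).2
      ⟨E.word.length - 1, by omega, by rw [hlast]; omega, by rw [eN, h0]; omega⟩) hstar
    have hb := (E.getElem_word_bounds (i := E.word.length - 1) (by omega)).1
    rw [hl] at hb
    have : n - 1 ≤ oneLine π (E.word.length - 1) := he ▸ hb
    omega
  · have eN' : E.word.length - 2 + 1 = E.word.length - 1 := by omega
    have hlast : oneLine π (E.word.length - 1) = 0 := by
      by_contra hne
      obtain ⟨y, hy, hy1⟩ := exists_oneLine_eq π (show 0 < n by omega)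
      have hyN : y ≠ n - 1 := by rintro rfl; omega
      have hlt : oneLine π y < oneLine π (E.word.length - 1) := by omega
      have hle := hc.letter_le y (E.word.length - 1) (by omega) (by omega) hlt
      rw [hl] at hle
      have heq : E.word[y]'(by omega) = extremeLetter hk false := Fin.ext (Nat.le_zero.1 hle)
      rcases hc.next y (E.word.length - 1) (by omega) (by omega) (heq.trans hl.symm) hlt with
        ⟨h, _⟩ | ⟨_, h⟩
      · rw [heq] at h
        exact absurd (hs'.symm.trans h) (by decide)
      · rw [eN] at h
        have := oneLine_lt π (show y + 1 < n by omega)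
        omega
    have hprev : oneLine π (E.word.length - 2) = n - 2 := by
      by_contra hne
      have hlt : oneLine π (E.word.length - 2) < oneLine π x := by
        have := ltN (E.word.length - 2) (by omega)
        omega
      have hle := hc.letter_le (E.word.length - 2) x (by omega) (by omega) hlt
      rw [hl'] at hle
      have heq := hmax _ hle
      rcases hc.next (E.word.length - 2) x (by omega) (by omega) (hl'.trans heq.symm) hlt with
        ⟨h, _⟩ | ⟨_, h⟩
      · rw [hl', hs] at h
        exact absurd h (by decide)
      · rw [eN'] at h
        omega
    have hb := (E.getElem_word_bounds (i := E.word.length - 2) (by omega)).1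
    have hb' := (E.getElem_word_bounds (i := E.word.length - 1) (by omega)).2
    rw [hl'] at hb
    rw [hl] at hb'
    rcases E.cond_d hs' hs
      ((entryEq_iff π).2 ⟨E.word.length - 1, by omega, by rw [hlast], by rw [eN, h0]; omega⟩)
      ((entryEq_iff π).2
        ⟨E.word.length - 2, by omega, by rw [hprev]; omega, by rw [eN', hlast]⟩) hstar with he | he
    · exact absurd (he ▸ hb' : _ < 0) (by omega)
    · have : n - 1 ≤ oneLine π (E.word.length - 2) := he ▸ hb
      omega

end Segmentation

theorem exists_periodic_words {k : ℕ} (σ : Fin k → ℤˣ) (ζ : List (Fin k)) (w : SignedWord σ) :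
    ∃ q : ℕ → SignedWord σ, ∀ i < ζ.length, prepend (ζ.drop i) (q i) = q i := by
  have : ∀ i, ∃ v : SignedWord σ, i < ζ.length → prepend (ζ.drop i) v = v := fun i => by
    by_cases hi : i < ζ.length
    · obtain ⟨v, hv⟩ := exists_prepend_eq_self (σ := σ) (IsCompatible.drop_ne_nil hi)
      exact ⟨v, fun _ => hv⟩
    · exact ⟨w, fun h => absurd h hi⟩
  exact ⟨fun i => (this i).choose, fun i hi => (this i).choose_spec hi⟩

theorem Segmentation.isAllowedPattern {k n : ℕ} {hk : 2 ≤ k} {hn : 1 ≤ n} {σ : Fin k → ℤˣ}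
    {π : Equiv.Perm (Fin n)} (E : Segmentation hk hn σ π) (hE : E.IsValid) :
    IsAllowedPattern (signedShift σ) π := by
  have hc := E.isCompatible_word
  have hN := E.length_word
  obtain ⟨q, hq⟩ := exists_periodic_words σ E.word (extreme hk σ false)
  obtain ⟨u, h1, h2⟩ : ∃ u, (∀ i < E.word.length, oneLine π i < oneLine π E.word.length → q i < u) ∧
      (∀ i < E.word.length, oneLine π E.word.length < oneLine π i → u < q i) := by
    rw [hN] at hq ⊢
    by_cases h0 : oneLine π (n - 1) = 0
    · refine ⟨extreme hk σ false, fun i hi h => by omega,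
        fun i hi _ => extreme_false_lt hk fun e => ?_⟩
      exact E.not_periodic_min (hN ▸ hi) h0 (e ▸ hq i hi)
    by_cases h1 : oneLine π (n - 1) = n - 1
    · refine ⟨extreme hk σ true, fun i hi _ => lt_extreme_true hk fun e => ?_, fun i hi h => ?_⟩
      · exact E.not_periodic_max (hN ▸ hi) h1 (e ▸ hq i hi)
      · have := oneLine_lt π (show i < n by omega)
        omega
    have hlt := oneLine_lt π (show n - 1 < n by omega)
    obtain ⟨x, hx, hPx⟩ := exists_oneLine_eq π (show oneLine π (n - 1) + 1 < n by omega)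
    obtain ⟨y, hy, hPy⟩ := exists_oneLine_eq π (show oneLine π (n - 1) - 1 < n by omega)
    have hxN : x ≠ n - 1 := by rintro rfl; omega
    have hyN : y ≠ n - 1 := by rintro rfl; omega
    have hPy' : oneLine π y + 1 = oneLine π (n - 1) := by omega
    rw [← hN] at hq hPx hPy' ⊢
    refine hc.exists_tail_of_middle hq (x := x) (y := y) (by omega) (by omega) hPx hPy'
      fun h => hE ⟨⟨x, hx⟩, ⟨y, hy⟩, ?_, ?_, h⟩
    · rwa [hN, oneLine_of_lt π hx, oneLine_of_lt π (show n - 1 < n by omega)] at hPx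
    · rwa [hN, oneLine_of_lt π hy, oneLine_of_lt π (show n - 1 < n by omega)] at hPy'
  have key : ∀ i j : Fin n, π i < π j →
      (signedShift σ)^[(i : ℕ)] (prepend E.word u) <
        (signedShift σ)^[(j : ℕ)] (prepend E.word u) := by
    intro i j hij
    rw [shift_iterate_prepend _ _ _ (by omega), shift_iterate_prepend _ _ _ (by omega)]
    refine hc.prepend_lt_prepend hq h1 h2 (by omega) (by omega) ?_
    rwa [oneLine_of_lt π i.isLt, oneLine_of_lt π j.isLt]
  refine ⟨prepend E.word u, fun i j hij => ?_, fun i j => ⟨fun h => ?_, key i j⟩⟩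
  · by_contra hne
    rcases lt_or_gt_of_ne (π.injective.ne hne) with h | h
    · exact (key i j h).ne hij
    · exact (key j i h).ne hij.symm
  · by_contra! hle
    rcases hle.lt_or_eq with h' | h'
    · exact (key j i h').asymm h
    · rw [π.injective h'] at h
      exact h.false

/-! ### From a word to a valid segmentation -/

namespace SignedWord

variable {k : ℕ} {σ : Fin k → ℤˣ}

theorem apply_zero_le_of_lt {v w : SignedWord σ} (h : v < w) : v 0 ≤ w 0 := by
  have h' : SignedLess σ v w := h
  cases h' with
  | first h => exact h.le
  | pos h _ _ => exact h.le
  | neg h _ _ => exact h.le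

theorem shift_lt_of_lt {v w : SignedWord σ} (h : v < w) (h0 : v 0 = w 0) :
    (σ (v 0) = 1 ∧ signedShift σ v < signedShift σ w) ∨
      (σ (v 0) = -1 ∧ signedShift σ w < signedShift σ v) := by
  have h' : SignedLess σ v w := h
  cases h' with
  | first h => exact absurd h0 h.ne
  | pos _ hs h => exact .inl ⟨hs, h⟩
  | neg _ hs h => exact .inr ⟨hs, h⟩

theorem shift_iterate_apply (w : SignedWord σ) (i j : ℕ) :
    (signedShift σ)^[i] w j = w (i + j) := by
  induction i generalizing w with
  | zero => rw [Nat.zero_add]; rfl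
  | succ i ih =>
    rw [Function.iterate_succ_apply, ih]
    exact congrArg w (by omega)

/-- The first `m` letters of an infinite word. -/
def initial (m : ℕ) (w : SignedWord σ) : List (Fin k) :=
  List.ofFn fun i : Fin m => w i

@[simp] theorem length_initial (m : ℕ) (w : SignedWord σ) : (initial m w).length = m := by
  simp [initial]

theorem getElem_initial {m : ℕ} {w : SignedWord σ} {i : ℕ} (hi : i < (initial m w).length) :
    (initial m w)[i] = w i := by
  simp [initial]

theorem prepend_initial (m : ℕ) (w : SignedWord σ) :
    prepend (initial m w) ((signedShift σ)^[m] w) = w := by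
  funext i
  rcases lt_or_ge i m with hi | hi
  · rw [prepend_apply_lt _ _ _ (by simpa using hi), getElem_initial]
  · obtain ⟨j, rfl⟩ := Nat.exists_eq_add_of_le hi
    have := prepend_apply_add (initial m w) ((signedShift σ)^[m] w) j
    rwa [length_initial, shift_iterate_apply] at this

end SignedWord

/-- The bars of a weakly monotone sequence of letters. -/
theorem exists_bars (n : ℕ) (L : ℕ → ℕ) (hL : ∀ i j, i ≤ j → j < n → L i ≤ L j) :
    ∃ e : ℕ → ℕ, (∀ t, e t ≤ n) ∧ ∀ t v, v < n → (v < e t ↔ L v < t) := by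
  classical
  have hex : ∀ t, ∃ m, n ≤ m ∨ t ≤ L m := fun t => ⟨n, .inl le_rfl⟩
  refine ⟨fun t => Nat.find (hex t), fun t => Nat.find_min' _ (.inl le_rfl), fun t v hv => ?_⟩
  rw [Nat.lt_find_iff]
  constructor
  · intro h
    have := h v le_rfl
    omega
  · intro h m hm
    have := hL m v hm hv
    omega

namespace IsCompatible

variable {k n : ℕ} {σ : Fin k → ℤˣ} {ζ : List (Fin k)} {π : Equiv.Perm (Fin n)}

/-- The letters of a compatible word, arranged by position and completed at the star. -/
theorem exists_letters (hn : 1 ≤ n) (hk : 2 ≤ k) (h : IsCompatible σ ζ (oneLine π))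
    (hN : ζ.length = n - 1) :
    ∃ L : ℕ → ℕ, (∀ i (hi : i < ζ.length), L (oneLine π i) = ζ[i]) ∧
      (oneLine π (n - 1) + 1 < n → L (oneLine π (n - 1)) = L (oneLine π (n - 1) + 1)) ∧
      (oneLine π (n - 1) + 1 = n → L (oneLine π (n - 1)) = k - 1) ∧
      (∀ i, L i < k) ∧ ∀ i j, i ≤ j → j < n → L i ≤ L j := by
  classical
  obtain ⟨s, hs⟩ : ∃ s, s = oneLine π (n - 1) := ⟨_, rfl⟩
  obtain ⟨I, hI⟩ : ∃ I : ℕ → ℕ, ∀ v < n, I v < n ∧ oneLine π (I v) = v := by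
    refine ⟨fun v => if hv : v < n then (exists_oneLine_eq π hv).choose else 0, fun v hv => ?_⟩
    simp only [hv, dite_true]
    exact (exists_oneLine_eq π hv).choose_spec
  obtain ⟨A, hA⟩ : ∃ A : ℕ → ℕ, ∀ v, A v = if hv : I v < ζ.length then (ζ[I v] : ℕ) else k - 1 :=
    ⟨_, fun _ => rfl⟩
  have hAk : ∀ v, A v < k := fun v => by
    rw [hA]
    split_ifs
    · exact Fin.isLt _
    · omega
  have hIs : ∀ v, v < n → v ≠ s → I v < ζ.length := fun v hv hvs => by
    have h1 := hI v hv
    have : I v ≠ n - 1 := fun e => hvs (by rw [hs, ← e, h1.2])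
    omega
  have hAmono : ∀ v w, v < n → w < n → v ≠ s → w ≠ s → v < w → A v ≤ A w := by
    intro v w hv hw hvs hws hvw
    have h1 := hIs v hv hvs
    have h2 := hIs w hw hws
    rw [hA, hA, dif_pos h1, dif_pos h2]
    exact h.letter_le _ _ h1 h2 (by rw [(hI v hv).2, (hI w hw).2]; exact hvw)
  have hne : s + 1 ≠ s := by omega
  rw [← hs]
  -- The star takes the letter of its right neighbour, or k-1 at the last position. No inner bar
  -- then stands immediately after the star, as (f) demands.
  refine ⟨fun v => if v = s then (if s + 1 < n then A (s + 1) else k - 1) else A v,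
    fun i hi => ?_, fun h => ?_, fun h => ?_, fun v => ?_, fun v w hvw hw => ?_⟩
  · have hin : i < n := by omega
    have h1 : oneLine π i ≠ s := fun e => by
      have := oneLine_inj π hin (show n - 1 < n by omega) (e.trans hs)
      omega
    have h2 : I (oneLine π i) = i := oneLine_inj π (hI _ (oneLine_lt π hin)).1 hin
      (hI _ (oneLine_lt π hin)).2
    simp only [h1, if_false, hA, h2, hi, dite_true]
  · simp [h]
  · simp [h]
  · dsimp only
    split_ifs
    · exact hAk _
    · omega
    · exact hAk _
  · rcases hvw.eq_or_lt with rfl | hvw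
    · exact le_rfl
    dsimp only
    by_cases hvs : v = s
    · rw [if_pos hvs, if_pos (by omega), if_neg (by omega)]
      by_cases e : w = s + 1
      · rw [e]
      · exact hAmono _ _ (by omega) hw hne (by omega) (by omega)
    · rw [if_neg hvs]
      by_cases hws : w = s
      · rw [if_pos hws]
        split_ifs with h
        · exact hAmono _ _ (by omega) h hvs hne (by omega)
        · have := hAk v
          omega
      · rw [if_neg hws]
        exact hAmono _ _ (by omega) hw hvs hws hvw

theorem eq_extreme_of_last (hk : 2 ≤ k) {q : ℕ → SignedWord σ}
    (hq : ∀ i < ζ.length, prepend (ζ.drop i) (q i) = q i) {b : Bool}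
    (hb : σ (extremeLetter hk b) = 1) {m : ℕ} (hm : m + 1 = ζ.length)
    (hl : ζ[m] = extremeLetter hk b) : q m = extreme hk σ b := by
  refine eq_of_prepend_eq_self (drop_ne_nil (by omega)) (hq m (by omega)) ?_
  rw [List.drop_eq_getElem_cons (by omega), hl, List.drop_eq_nil_of_le (by omega)]
  exact prepend_single_extreme hk hb

theorem eq_extreme_of_last_two (hk : 2 ≤ k) {q : ℕ → SignedWord σ}
    (hq : ∀ i < ζ.length, prepend (ζ.drop i) (q i) = q i) {b : Bool}
    (hb : σ (extremeLetter hk b) = -1) (hb' : σ (extremeLetter hk (!b)) = -1) {m : ℕ}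
    (hm : m + 2 = ζ.length) (hl : ζ[m] = extremeLetter hk b)
    (hl' : ζ[m + 1] = extremeLetter hk (!b)) : q m = extreme hk σ b := by
  refine eq_of_prepend_eq_self (drop_ne_nil (by omega)) (hq m (by omega)) ?_
  rw [List.drop_eq_getElem_cons (by omega), hl, List.drop_eq_getElem_cons (by omega), hl',
    List.drop_eq_nil_of_le (by omega)]
  exact prepend_pair_extreme hk hb hb'

/-- Only the word u in the gap is needed. A violation of (b)–(e) would make some q_i the extreme
word on the side where u must still fit, and invalidity would make the bounds q_y < u < q_x
coincide. -/
theorem exists_valid_segmentation (hk : 2 ≤ k) (hn : 1 ≤ n) (h : IsCompatible σ ζ (oneLine π))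
    (hN : ζ.length = n - 1) {q : ℕ → SignedWord σ}
    (hq : ∀ i < ζ.length, prepend (ζ.drop i) (q i) = q i) {u : SignedWord σ}
    (h1 : ∀ i < ζ.length, oneLine π i < oneLine π (n - 1) → q i < u)
    (h2 : ∀ i < ζ.length, oneLine π (n - 1) < oneLine π i → u < q i) :
    ∃ E : Segmentation hk hn σ π, E.IsValid := by
  obtain ⟨L, hLζ, hLs, hLn, hLk, hLmono⟩ := h.exists_letters hn hk hN
  obtain ⟨e, hen, he⟩ := exists_bars n L hLmono
  have hPlt := fun i hi => oneLine_lt π (i := i) hi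
  have hs := hPlt (n - 1) (by omega)
  have inj := fun i j hi hj => oneLine_inj π (i := i) (j := j) hi hj
  have q_ne_min : oneLine π (n - 1) = 0 → ∀ i < ζ.length, q i ≠ extreme hk σ false :=
    fun h0 i hi => (ne_extreme_of_lt hk (h2 i hi (by
      have : oneLine π i ≠ oneLine π (n - 1) := fun e => by
        have := inj _ _ (by omega) (by omega) e; omega
      omega))).1
  have q_ne_max : oneLine π (n - 1) = n - 1 → ∀ i < ζ.length, q i ≠ extreme hk σ true :=
    fun h0 i hi => (ne_extreme_of_lt hk (h1 i hi (by
      have : oneLine π i ≠ oneLine π (n - 1) := fun e => by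
        have := inj _ _ (by omega) (by omega) e; omega
      have := hPlt i (by omega)
      omega))).2
  have e_pos : ∀ t, e t ≠ 0 → L 0 < t := fun t ht => (he t 0 (by omega)).1 (by omega)
  have is_min : ∀ i (hi : i < ζ.length), L (oneLine π i) < 1 → ζ[i] = extremeLetter hk false :=
    fun i hi hl => Fin.ext (by rw [← hLζ i hi]; exact Nat.lt_one_iff.1 hl)
  have is_max : ∀ i (hi : i < ζ.length), ¬ L (oneLine π i) < k - 1 →
      ζ[i] = extremeLetter hk true := fun i hi hl => Fin.ext (by
    rw [hLζ i hi] at hl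
    have := ζ[i].isLt
    show (ζ[i] : ℕ) = k - 1
    omega)
  have block : ∀ (t : Fin k) (i j : Fin n), e t ≤ i → i < j → (j : ℕ) < e (t + 1) →
      ∀ v w : Fin n, markedCycle π i = some v → markedCycle π j = some w →
        (σ t = 1 ∧ v < w) ∨ (σ t = -1 ∧ w < v) := by
    intro t i j hi hij hj v w hv hw
    obtain ⟨a, ha, hai, hav⟩ := (markedCycle_eq_some_iff π).1 hv
    obtain ⟨b, hb, hbj, hbw⟩ := (markedCycle_eq_some_iff π).1 hw
    have hij' : (i : ℕ) < j := hij
    have hLi := mt (he t i i.isLt).2 (not_lt.2 hi)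
    have hLj := (he (t + 1) j j.isLt).1 hj
    have hLij := hLmono i j hij'.le j.isLt
    rw [← hai] at hLi hLij
    rw [← hbj] at hLj hLij
    rw [hLζ a (by omega)] at hLi hLij
    rw [hLζ b (by omega)] at hLj hLij
    have hat : ζ[a]'(by omega) = t := Fin.ext (by omega)
    have hbt : ζ[b]'(by omega) = t := Fin.ext (by omega)
    have := h.next a b (by omega) (by omega) (hat.trans hbt.symm) (by omega)
    rwa [hat, hav, hbw] at this
  let E : Segmentation hk hn σ π :=
    { e := fun t => e t
      mono := by
        intro s t hst
        by_contra! hlt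
        have hlt' : e t < e s := hlt
        have h1 := hen s
        have h2 := (he s (e t) (by omega)).1 hlt'
        have h3 := mt (he t (e t) (by omega)).2 (lt_irrefl _)
        have : (s : ℕ) ≤ t := hst
        omega
      e_zero := by
        by_contra hne
        exact absurd (e_pos _ hne) (Nat.not_lt_zero _)
      e_last := by
        have h1 := hen k
        have h2 := (he k (n - 1) (by omega)).2 (hLk _)
        rw [Fin.val_last]
        omega
      increasing := fun t ht i j hi hij hj v w hv hw =>
        (block t i j hi hij hj v w hv hw).elim And.right
          fun h => absurd (ht.symm.trans h.1) (by decide)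
      decreasing := fun t ht i j hi hij hj v w hv hw =>
        (block t i j hi hij hj v w hv hw).elim
          (fun h => absurd (h.1.symm.trans ht) (by decide)) And.right
      cond_b := by
        intro hσ hst hen
        rw [entryStar_iff π hn] at hst
        obtain ⟨i, hi, hi1, hi2⟩ := (entryEq_iff π).1 hen
        by_contra hne
        have hL0 := e_pos _ hne
        have := inj (i + 1) (n - 1) hi (by omega) (by omega)
        refine q_ne_min (by omega) i (by omega) (eq_extreme_of_last (b := false) hk hq hσ (by omega)
          (is_min i (by omega) ?_))
        -- The first position is the star and shares its letter 0 with the second position, whose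
        -- letter is the last one of ζ; hence that periodic word is minimal.
        have := hLs (by omega)
        rw [show oneLine π (n - 1) + 1 = oneLine π i by omega,
          show oneLine π (n - 1) = 0 by omega] at this
        rw [← this]
        exact hL0
      cond_c := by
        intro hσ hen' hst
        rw [entryStar_iff π hn] at hst
        obtain ⟨i, hi, hi1, hi2⟩ := (entryEq_iff π).1 hen'
        have hLN := hLn hst
        have := inj (i + 1) (n - 1) hi (by omega) (by omega)
        by_contra hne
        have hne' : e (k - 1) ≠ n - 1 := hne
        have h3 := (he (k - 1) (n - 1) (by omega)).1
        rw [show oneLine π (n - 1) = n - 1 by omega] at hLN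
        refine q_ne_max (by omega) i (by omega) (eq_extreme_of_last (b := true) hk hq hσ (by omega)
          (is_max i (by omega) fun hlt => ?_))
        have h4 := (he (k - 1) _ (hPlt i (by omega))).2 hlt
        omega
      cond_d := by
        intro hσ hσ' hen1 hen2 hst
        rw [entryStar_iff π hn] at hst
        obtain ⟨i, hi, hi1, hi2⟩ := (entryEq_iff π).1 hen1
        obtain ⟨j, hj, hj1, hj2⟩ := (entryEq_iff π).1 hen2
        have e1 := inj (i + 1) (n - 1) hi (by omega) (by omega)
        have e2 := inj (j + 1) i hj (by omega) (by omega)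
        subst e2
        have hLN := hLn hst
        rw [show oneLine π (n - 1) = n - 1 by omega] at hLN
        by_contra! hne
        have hne' : e (k - 1) ≠ n - 1 := hne.2
        have h3 := (he (k - 1) (n - 1) (by omega)).1
        have hL0 := e_pos _ hne.1
        refine q_ne_max (by omega) j (by omega) (eq_extreme_of_last_two (b := true) hk hq hσ' hσ
          (by omega)
          (is_max j (by omega) fun hlt => ?_) (is_min (j + 1) (by omega) ?_))
        · have h4 := (he (k - 1) _ (hPlt j (by omega))).2 hlt
          omega
        · rw [show oneLine π (j + 1) = 0 by omega]
          exact hL0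
      cond_e := by
        intro hσ hσ' hst hen1 hen2
        rw [entryStar_iff π hn] at hst
        obtain ⟨i, hi, hi1, hi2⟩ := (entryEq_iff π).1 hen2
        obtain ⟨j, hj, hj1, hj2⟩ := (entryEq_iff π).1 hen1
        have e1 := inj (i + 1) (n - 1) hi (by omega) (by omega)
        have e2 := inj (j + 1) i hj (by omega) (by omega)
        subst e2
        by_contra! hne
        have hne' : e (k - 1) ≠ n := hne.2
        have h3 := hen (k - 1)
        have h4 := mt (he (k - 1) (n - 1) (by omega)).2
        have hL0 := e_pos _ hne.1
        have hL1 := hLs (by omega)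
        rw [show oneLine π (n - 1) + 1 = oneLine π j by omega,
          show oneLine π (n - 1) = 0 by omega] at hL1
        refine q_ne_min (by omega) j (by omega) (eq_extreme_of_last_two (b := false) hk hq hσ hσ'
          (by omega)
          (is_min j (by omega) ?_) (is_max (j + 1) (by omega) ?_))
        · rw [← hL1]
          exact hL0
        · rw [show oneLine π (j + 1) = n - 1 by omega]
          exact h4 (by omega)
      cond_f := by
        intro t ht htk het
        rw [← oneLine_of_lt π (show n - 1 < n by omega)] at het
        have h3 := (he t (oneLine π (n - 1)) hs).1 (by omega)
        rcases (Nat.succ_le_of_lt hs).eq_or_lt with heq | hlt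
        · have := hLn heq
          omega
        · rw [hLs hlt] at h3
          have := (he t _ hlt).2 h3
          omega }
  have hword : E.word = ζ := by
    refine List.ext_getElem (by rw [E.length_word, hN]) fun i hi hi' => ?_
    obtain ⟨hb, hb'⟩ := E.getElem_word_bounds hi
    have hPi := hPlt i (by omega)
    have hb1 : e E.word[i] ≤ oneLine π i := hb
    have hb2 : oneLine π i < e (E.word[i] + 1) := hb'
    have h3 := (he _ _ hPi).1 hb2
    have h4 := mt (he E.word[i] _ hPi).2 (not_lt.2 hb1)
    rw [hLζ i hi'] at h3 h4
    exact Fin.ext (by omega)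
  refine ⟨E, ?_⟩
  rintro ⟨x, y, hx, hy, hxy⟩
  rw [hword] at hxy
  rw [← oneLine_of_lt π x.isLt, ← oneLine_of_lt π (show n - 1 < n by omega)] at hx
  rw [← oneLine_of_lt π y.isLt, ← oneLine_of_lt π (show n - 1 < n by omega)] at hy
  have hxN : (x : ℕ) ≠ n - 1 := fun e => by rw [e] at hx; omega
  have hyN : (y : ℕ) ≠ n - 1 := fun e => by rw [e] at hy; omega
  have hx' : (x : ℕ) < ζ.length := by omega
  have hy' : (y : ℕ) < ζ.length := by omega
  -- A word and its square have the same periodic word, contradicting q_y < u < q_x.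
  refine ((h1 y hy' (by omega)).trans (h2 x hx' (by omega))).ne ?_
  rcases hxy with e | e
  · refine eq_of_prepend_eq_self (drop_ne_nil hx') ?_ (hq x hx')
    rw [e, prepend_append, hq y hy', hq y hy']
  · refine eq_of_prepend_eq_self (drop_ne_nil hy') (hq y hy') ?_
    rw [e, prepend_append, hq x hx', hq x hx']

end IsCompatible

theorem Induces.exists_valid_segmentation {k n : ℕ} (hk : 2 ≤ k) (hn : 1 ≤ n) {σ : Fin k → ℤˣ}
    {π : Equiv.Perm (Fin n)} {w : SignedWord σ} (h : Induces (signedShift σ) w π) :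
    ∃ E : Segmentation hk hn σ π, E.IsValid := by
  have hlt : ∀ i j, i < n → j < n → oneLine π i < oneLine π j →
      (signedShift σ)^[i] w < (signedShift σ)^[j] w := by
    intro i j hi hj hij
    rw [oneLine_of_lt π hi, oneLine_of_lt π hj] at hij
    exact (h.2 ⟨i, hi⟩ ⟨j, hj⟩).2 hij
  have hgt : ∀ i j, i < n → j < n → (signedShift σ)^[i] w < (signedShift σ)^[j] w →
      oneLine π i < oneLine π j := by
    intro i j hi hj hij
    rw [oneLine_of_lt π hi, oneLine_of_lt π hj]
    exact (h.2 ⟨i, hi⟩ ⟨j, hj⟩).1 hij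
  obtain ⟨ζ, hζ⟩ : ∃ ζ, ζ = initial (n - 1) w := ⟨_, rfl⟩
  have hN : ζ.length = n - 1 := by rw [hζ, length_initial]
  have hget : ∀ i (hi : i < ζ.length), ζ[i] = (signedShift σ)^[i] w 0 := by
    subst hζ
    intro i hi
    rw [getElem_initial, shift_iterate_apply, Nat.add_zero]
  have hc : IsCompatible σ ζ (oneLine π) :=
    { inj := fun i j hi hj e => oneLine_inj π (by omega) (by omega) e
      letter_le := fun i j hi hj hij => by
        rw [hget, hget]
        exact apply_zero_le_of_lt (hlt i j (by omega) (by omega) hij)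
      next := fun i j hi hj heq hij => by
        rw [hget i hi, hget j hj] at heq
        rw [hget i hi]
        have := shift_lt_of_lt (hlt i j (by omega) (by omega) hij) heq
        rw [← Function.iterate_succ_apply' (signedShift σ),
          ← Function.iterate_succ_apply' (signedShift σ)] at this
        exact this.imp (And.imp_right (hgt _ _ (by omega) (by omega)))
          (And.imp_right (hgt _ _ (by omega) (by omega))) }
  obtain ⟨q, hq⟩ := exists_periodic_words σ ζ w
  have hpre : ∀ i < ζ.length, prepend (ζ.drop i) ((signedShift σ)^[n - 1] w) =
      (signedShift σ)^[i] w := fun i hi => by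
    rw [← shift_iterate_prepend _ ζ i hi.le, hζ, prepend_initial]
  -- The tail of w after n-1 letters lies in the gap, because its comparisons with earlier shifts
  -- are comparisons of u with su.
  refine hc.exists_valid_segmentation hk hn hN hq (u := (signedShift σ)^[n - 1] w)
    (fun i hi hlt' => ?_) fun i hi hlt' => ?_
  · rw [← prepend_lt_iff (IsCompatible.drop_ne_nil hi) (hq i hi), hpre i hi]
    exact hlt _ _ (by omega) (by omega) hlt'
  · rw [← lt_prepend_iff (IsCompatible.drop_ne_nil hi) (hq i hi), hpre i hi]
    exact hlt _ _ (by omega) (by omega) hlt'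

theorem mainTheorem1 {k n : ℕ} (hk : 2 ≤ k) (hn : 1 ≤ n) (σ : Fin k → ℤˣ)
    (π : Equiv.Perm (Fin n)) :
    IsAllowedPattern (signedShift σ) π ↔ ∃ E : Segmentation hk hn σ π, E.IsValid :=
  ⟨fun ⟨_, h⟩ => h.exists_valid_segmentation hk hn, fun ⟨E, hE⟩ => E.isAllowedPattern hE⟩
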